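/- Let $\beta,\omega>0$. Consider a double chain of $N$ sites, each site $k$ carrying two one-dimensional harmonic oscillators with canonical operators $x^{[k]}_\alpha,p^{[k]}_\alpha$ ($\alpha=1,2$), $[x^{[j]}_\alpha,p^{[k]}_{\alpha'}]=i\,\delta_{jk}\delta_{\alpha\alpha'}$, in their irreducible (number) representation. Let $$H^{(N)}=\sum_{k=1}^N\sum_{\alpha=1}^2\frac{\omega}{2}\Big[(x^{[k]}_\alpha)^2+(p^{[k]}_\alpha)^2\Big],\qquad \rho^{(N)}=\frac{e^{-\beta H^{(N)}}}{\operatorname{tr}e^{-\beta H^{(N)}}},\qquad \langle O\rangle_N=\operatorname{tr}\big[\rho^{(N)}O\big].$$ A single-site observable is a (bounded or unbounded) essentially self-adjoint operator $X$ on the one-site Hilbert space whose domain contains the number states and whose second moment in the one-site thermal state is finite; $\langle X\rangle$ denotes its expectation in that state. Write $X^{[k]}$ for the copy of $X$ acting at site $k$ and trivially at the other sites, and $$X^{(N)}=\frac1N\sum_{k=1}^N X^{[k]} .$$ Let $n\ge 0$ and let $X_1,\dots,X_n$ be single-site observables. Then $$\lim_{N\to\infty}\Big\langle e^{iX_1^{(N)}}e^{iX_2^{(N)}}\cdots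 e^{iX_n^{(N)}}\Big\rangle_N=\exp\Big(i\sum_{j=1}^n\langle X_j\rangle\Big),$$ and, if moreover $\sum_{j=1}^n X_j$ is essentially self-adjoint on the intersection of the domains of the $X_j$ (so that the exponential of the sum is defined), $$\lim_{N\to\infty}\Big\langle e^{\,i\sum_{j=1}^n X_j^{(N)}}\Big\rangle_N=\exp\Big(i\sum_{j=1}^n\langle X_j\rangle\Big).$$ Here $e^{iA}$, for an essentially self-adjoint $A$, is the value at $t=1$ of the strongly continuous unitary group $e^{itA}$ generated by the closure of $A$. -/

import Mathlib

open Filter Topology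
open scoped ComplexInnerProductSpace

noncomputable section

namespace OscillatorChain

/-! ### Exponentials of unbounded self-adjoint operators -/

/-- A partially defined operator is essentially self-adjoint if its closure is self-adjoint. -/
def IsEssentiallySelfAdjoint {E : Type*} [NormedAddCommGroup E] [InnerProductSpace ℂ E]
    [CompleteSpace E] (A : E →ₗ.[ℂ] E) : Prop :=
  IsSelfAdjoint A.closure

/-- `U` is a strongly continuous one-parameter unitary group whose (self-adjoint) generator
extends `A`, i.e. `U t = e^{itA}`.  If `A` is essentially self-adjoint there is exactly one such
`U`, namely the group generated by the closure of `A` (Stone). -/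
structure IsUnitaryGroupOf {E : Type*} [NormedAddCommGroup E] [InnerProductSpace ℂ E]
    [CompleteSpace E] (A : E →ₗ.[ℂ] E) (U : ℝ → E →L[ℂ] E) : Prop where
  map_zero : U 0 = 1
  map_add : ∀ s t : ℝ, U (s + t) = U s * U t
  mem_unitary : ∀ t : ℝ, U t ∈ unitary (E →L[ℂ] E)
  continuous : ∀ ψ : E, Continuous fun t : ℝ => U t ψ
  hasDerivAt : ∀ ψ : A.domain, HasDerivAt (fun t : ℝ => U t (ψ : E)) (Complex.I • A ψ) 0

open Classical in
/-- The unitary operator `e^{iA}`: the value at `t = 1` of the one-parameter unitary group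
`e^{itA}` of an essentially self-adjoint operator `A` (and `0` if no such group exists). -/
def unitaryExp {E : Type*} [NormedAddCommGroup E] [InnerProductSpace ℂ E] [CompleteSpace E]
    (A : E →ₗ.[ℂ] E) : E →L[ℂ] E :=
  if h : ∃ U : ℝ → E →L[ℂ] E, IsUnitaryGroupOf A U then h.choose 1 else 0

/-! ### Oscillators in the number representation

A finite set `ι` of one-dimensional oscillators; `n : ι → ℕ` are the occupation numbers. -/

/-- The algebraic span of the number states `|n⟩`. -/
abbrev Core (ι : Type) : Type := (ι → ℕ) →₀ ℂ

/-- The Hilbert space of the oscillators, `ℓ²` over the number states. -/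
abbrev Fock (ι : Type) : Type := lp (fun _ : ι → ℕ => ℂ) 2

/-- The normalized number state `|n⟩` in the Hilbert space. -/
def ket {ι : Type} [Fintype ι] [DecidableEq ι] (n : ι → ℕ) : Fock ι := lp.single 2 n (1 : ℂ)

/-- `a_i |n⟩ = √(n_i) |n - δ_i⟩`. -/
def annihilation {ι : Type} [DecidableEq ι] (i : ι) : Core ι →ₗ[ℂ] Core ι :=
  Finsupp.linearCombination ℂ fun n : ι → ℕ =>
    Finsupp.single (Function.update n i (n i - 1)) ((Real.sqrt (n i) : ℝ) : ℂ)

/-- `a_i† |n⟩ = √(n_i + 1) |n + δ_i⟩`. -/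
def creation {ι : Type} [DecidableEq ι] (i : ι) : Core ι →ₗ[ℂ] Core ι :=
  Finsupp.linearCombination ℂ fun n : ι → ℕ =>
    Finsupp.single (Function.update n i (n i + 1)) ((Real.sqrt (n i + 1) : ℝ) : ℂ)

/-- The position operator `x_i = (a_i + a_i†) / √2`. -/
def position {ι : Type} [DecidableEq ι] (i : ι) : Core ι →ₗ[ℂ] Core ι :=
  ((Real.sqrt 2 : ℝ) : ℂ)⁻¹ • (annihilation i + creation i)

/-- The momentum operator `p_i = (a_i - a_i†) / (i √2)`. -/
def momentum {ι : Type} [DecidableEq ι] (i : ι) : Core ι →ₗ[ℂ] Core ι :=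
  (Complex.I * ((Real.sqrt 2 : ℝ) : ℂ))⁻¹ • (annihilation i - creation i)

/-- The total Hamiltonian `H = ∑_i (ω / 2) (x_i² + p_i²)` of free oscillators. -/
def hamiltonian {ι : Type} [Fintype ι] [DecidableEq ι] (ω : ℝ) : Core ι →ₗ[ℂ] Core ι :=
  ∑ i : ι, ((ω / 2 : ℝ) : ℂ) • (position i ∘ₗ position i + momentum i ∘ₗ momentum i)

/-- The diagonal matrix element `⟨n| H |n⟩`. The number states are eigenvectors of `H`
(`hamiltonian_single`), so these are the eigenvalues of `H`. -/
def energy {ι : Type} [Fintype ι] [DecidableEq ι] (ω : ℝ) (n : ι → ℕ) : ℝ :=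
  (hamiltonian ω (Finsupp.single n 1) n).re

lemma annihilation_single {ι : Type} [DecidableEq ι] (i : ι) (n : ι → ℕ) (c : ℂ) :
    annihilation i (Finsupp.single n c) =
      Finsupp.single (Function.update n i (n i - 1)) (c * ((Real.sqrt (n i) : ℝ) : ℂ)) := by
  simp [annihilation]

lemma creation_single {ι : Type} [DecidableEq ι] (i : ι) (n : ι → ℕ) (c : ℂ) :
    creation i (Finsupp.single n c) =
      Finsupp.single (Function.update n i (n i + 1)) (c * ((Real.sqrt (n i + 1) : ℝ) : ℂ)) := by
  simp [creation]

lemma creation_annihilation_single {ι : Type} [DecidableEq ι] (i : ι) (n : ι → ℕ) :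
    creation i (annihilation i (Finsupp.single n 1)) = Finsupp.single n (n i : ℂ) := by
  rw [annihilation_single, creation_single]
  rcases Nat.eq_zero_or_pos (n i) with h | h
  · simp [h]
  · have h1 : n i - 1 + 1 = n i := Nat.sub_add_cancel h
    have h2 : ((n i - 1 : ℕ) : ℝ) + 1 = n i := by exact_mod_cast h1
    simp only [Function.update_self, Function.update_idem, h1, h2, Function.update_eq_self, one_mul]
    rw [← Complex.ofReal_mul, Real.mul_self_sqrt (Nat.cast_nonneg _), Complex.ofReal_natCast]

lemma annihilation_creation_single {ι : Type} [DecidableEq ι] (i : ι) (n : ι → ℕ) :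
    annihilation i (creation i (Finsupp.single n 1)) = Finsupp.single n ((n i : ℂ) + 1) := by
  rw [creation_single, annihilation_single]
  have h0 : (0 : ℝ) ≤ (n i : ℝ) + 1 := by positivity
  simp only [Function.update_self, Function.update_idem, Nat.add_sub_cancel,
    Function.update_eq_self, one_mul]
  push_cast
  rw [← Complex.ofReal_mul, Real.mul_self_sqrt h0]
  push_cast
  rfl

lemma hamiltonian_single {ι : Type} [Fintype ι] [DecidableEq ι] (ω : ℝ) (n : ι → ℕ) :
    hamiltonian ω (Finsupp.single n (1 : ℂ)) =
      ((ω * ∑ i, ((n i : ℝ) + 1 / 2) : ℝ) : ℂ) • Finsupp.single n (1 : ℂ) := by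
  have hs : (((Real.sqrt 2 : ℝ) : ℂ)⁻¹) * (((Real.sqrt 2 : ℝ) : ℂ)⁻¹) = 1 / 2 := by
    rw [← mul_inv, ← Complex.ofReal_mul, Real.mul_self_sqrt (by norm_num)]
    norm_num
  have key : ∀ i : ι, (position i ∘ₗ position i + momentum i ∘ₗ momentum i)
      (Finsupp.single n (1 : ℂ)) = ((2 * (n i : ℂ) + 1)) • Finsupp.single n (1 : ℂ) := by
    intro i
    have hI : ((Complex.I * ((Real.sqrt 2 : ℝ) : ℂ))⁻¹) * ((Complex.I * ((Real.sqrt 2 : ℝ) : ℂ))⁻¹)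
        = -(1 / 2) := by
      rw [mul_inv, mul_mul_mul_comm, hs, ← mul_inv, Complex.I_mul_I]
      norm_num
    have hx : ∀ v : Core ι, position i (position i v) = (1 / 2 : ℂ) •
        ((annihilation i + creation i) ((annihilation i + creation i) v)) := by
      intro v
      rw [← hs, mul_smul]
      simp only [position, LinearMap.smul_apply, map_smul]
    have hp : ∀ v : Core ι, momentum i (momentum i v) = (-(1 / 2) : ℂ) •
        ((annihilation i - creation i) ((annihilation i - creation i) v)) := by
      intro v
      rw [← hI, mul_smul]
      simp only [momentum, LinearMap.smul_apply, map_smul]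
    have h3 : (position i ∘ₗ position i + momentum i ∘ₗ momentum i) (Finsupp.single n (1 : ℂ)) =
        creation i (annihilation i (Finsupp.single n 1)) +
          annihilation i (creation i (Finsupp.single n 1)) := by
      simp only [LinearMap.add_apply, LinearMap.comp_apply, hx, hp, LinearMap.sub_apply, map_add,
        map_sub]
      module
    rw [h3, creation_annihilation_single, annihilation_creation_single, ← Finsupp.single_add,
      Finsupp.smul_single]
    congr 1
    simp
    ring
  simp only [hamiltonian, LinearMap.sum_apply, LinearMap.smul_apply, key]
  rw [Finset.mul_sum]
  push_cast
  rw [Finset.sum_smul]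
  refine Finset.sum_congr rfl fun i _ => ?_
  rw [smul_smul]
  congr 1
  ring

lemma energy_eq {ι : Type} [Fintype ι] [DecidableEq ι] (ω : ℝ) (n : ι → ℕ) :
    energy ω n = ω * ∑ i, ((n i : ℝ) + 1 / 2) := by
  rw [energy, hamiltonian_single, Finsupp.smul_apply, Finsupp.single_eq_same, smul_eq_mul,
    mul_one, Complex.ofReal_re]

/-! ### The thermal state -/

/-- The eigenvalue `e^{-β E_n} / tr e^{-βH}` of the Gibbs state at the number state `|n⟩`. -/
def gibbsWeight {ι : Type} [Fintype ι] [DecidableEq ι] (β ω : ℝ) (n : ι → ℕ) : ℝ :=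
  Real.exp (-β * energy ω n) / ∑' m : ι → ℕ, Real.exp (-β * energy ω m)

lemma abs_gibbsWeight_le_one {ι : Type} [Fintype ι] [DecidableEq ι] (β ω : ℝ) (n : ι → ℕ) :
    |gibbsWeight β ω n| ≤ 1 := by
  have h0 : (0 : ℝ) ≤ ∑' m : ι → ℕ, Real.exp (-β * energy ω m) :=
    tsum_nonneg fun m => (Real.exp_pos _).le
  rw [gibbsWeight, abs_of_nonneg (div_nonneg (Real.exp_pos _).le h0)]
  by_cases hs : Summable fun m : ι → ℕ => Real.exp (-β * energy ω m)
  · exact div_le_one_of_le₀ (hs.le_tsum n fun m _ => (Real.exp_pos _).le) h0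
  · rw [tsum_eq_zero_of_not_summable hs, div_zero]
    exact zero_le_one

lemma memℓp_gibbs {ι : Type} [Fintype ι] [DecidableEq ι] (β ω : ℝ) (ψ : Fock ι) :
    Memℓp (fun n => (gibbsWeight β ω n : ℂ) * ψ n) 2 := by
  refine memℓp_gen ((lp.memℓp ψ).summable (by norm_num) |>.of_nonneg_of_le
    (fun n => by positivity) fun n => ?_)
  gcongr
  rw [norm_mul, Complex.norm_real, Real.norm_eq_abs]
  exact mul_le_of_le_one_left (norm_nonneg _) (abs_gibbsWeight_le_one β ω n)

/-- The density operator `ρ = e^{-βH} / tr e^{-βH}`, diagonal in the number states. -/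
def gibbs {ι : Type} [Fintype ι] [DecidableEq ι] (β ω : ℝ) : Fock ι →L[ℂ] Fock ι :=
  LinearMap.mkContinuous
    { toFun := fun ψ => ⟨fun n => (gibbsWeight β ω n : ℂ) * ψ n, memℓp_gibbs β ω ψ⟩
      map_add' := fun ψ φ => by
        ext n
        exact mul_add _ _ _
      map_smul' := fun c ψ => by
        ext n
        exact mul_left_comm _ _ _ }
    1 fun ψ => by
      rw [one_mul]
      refine lp.norm_le_of_forall_sum_le (by norm_num) (norm_nonneg _) fun s => ?_
      refine le_trans (Finset.sum_le_sum fun n _ => ?_)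
        (lp.sum_rpow_le_norm_rpow (by norm_num) ψ s)
      change ‖(gibbsWeight β ω n : ℂ) * ψ n‖ ^ _ ≤ _
      gcongr
      rw [norm_mul, Complex.norm_real, Real.norm_eq_abs]
      exact mul_le_of_le_one_left (norm_nonneg _) (abs_gibbsWeight_le_one β ω n)

open Classical in
/-- The trace `∑_n ⟨n| T |n⟩` of an operator whose domain contains all number states. -/
def trace {ι : Type} [Fintype ι] [DecidableEq ι] (T : Fock ι →ₗ.[ℂ] Fock ι) : ℂ :=
  ∑' n : ι → ℕ, if h : ket n ∈ T.domain then ⟪(ket n : Fock ι), T ⟨ket n, h⟩⟫ else 0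

/-- The thermal expectation `⟨O⟩ = tr (ρ O)` of a possibly unbounded operator. -/
def expectation {ι : Type} [Fintype ι] [DecidableEq ι] (β ω : ℝ) (O : Fock ι →ₗ.[ℂ] Fock ι) : ℂ :=
  trace ((gibbs β ω : Fock ι →L[ℂ] Fock ι).toLinearMap.compPMap O)

/-- The thermal expectation `⟨O⟩ = tr (ρ O)` of a bounded operator. -/
def boundedExpectation {ι : Type} [Fintype ι] [DecidableEq ι] (β ω : ℝ)
    (O : Fock ι →L[ℂ] Fock ι) : ℂ :=
  expectation β ω (O.toLinearMap.toPMap ⊤)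

/-! ### Single-site and mean-field observables of the double chain -/

/-- The Hilbert space of one site: two oscillators, one in each chain. -/
abbrev SiteSpace : Type := Fock (Fin 2)

/-- The Hilbert space of the double chain with `N` sites; `(k, α)` is the oscillator of the
chain `α` at the site `k`. -/
abbrev ChainSpace (N : ℕ) : Type := Fock (Fin N × Fin 2)

/-- A single-site observable: an essentially self-adjoint operator on the one-site Hilbert space,
defined on all number states, whose second moment `⟨X²⟩ = ∑_n ρ_n ‖X |n⟩‖²` in the thermal state
is finite. -/
structure IsObservable (β ω : ℝ) (X : SiteSpace →ₗ.[ℂ] SiteSpace) : Prop where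
  essentiallySelfAdjoint : IsEssentiallySelfAdjoint X
  ket_mem : ∀ n : Fin 2 → ℕ, ket n ∈ X.domain
  secondMoment : Summable fun n : Fin 2 → ℕ => gibbsWeight β ω n * ‖X ⟨ket n, ket_mem n⟩‖ ^ 2

/-- The occupation numbers equal to `a` at the site `k` and to `m` at all other sites. -/
def insertSite {N : ℕ} (k : Fin N) (m : Fin N × Fin 2 → ℕ) (a : Fin 2 → ℕ) : Fin N × Fin 2 → ℕ :=
  fun i => if i.1 = k then a i.2 else m i

lemma insertSite_injective {N : ℕ} (k : Fin N) (m : Fin N × Fin 2 → ℕ) :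
    Function.Injective (insertSite k m) := by
  intro a b h
  funext α
  simpa [insertSite] using congrFun h (k, α)

/-- The partial inner product `⟨m|ψ⟩` with the number state `m` of all sites other than `k`. -/
def slice {N : ℕ} (k : Fin N) (m : Fin N × Fin 2 → ℕ) : ChainSpace N →ₗ[ℂ] SiteSpace where
  toFun ψ := ⟨fun a => ψ (insertSite k m a), memℓp_gen (((lp.memℓp ψ).summable
    (by norm_num)).comp_injective (insertSite_injective k m))⟩
  map_add' ψ φ := by
    ext a
    rfl
  map_smul' c ψ := by
    ext a
    rfl

/-- The graph of `X^{[k]}`: all pairs `(ψ, φ)` such that `φ` arises from `ψ` by applying `X` at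
the site `k`, for each number state of the other sites. -/
def atSiteGraph {N : ℕ} (k : Fin N) (X : SiteSpace →ₗ.[ℂ] SiteSpace) :
    Submodule ℂ (ChainSpace N × ChainSpace N) :=
  ⨅ m : Fin N × Fin 2 → ℕ, X.graph.comap ((slice k m).prodMap (slice k m))

/-- The operator `X^{[k]} = 1 ⊗ ⋯ ⊗ X ⊗ ⋯ ⊗ 1` acting as `X` at the site `k` and trivially at all
other sites. -/
def atSite {N : ℕ} (k : Fin N) (X : SiteSpace →ₗ.[ℂ] SiteSpace) :
    ChainSpace N →ₗ.[ℂ] ChainSpace N :=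
  (atSiteGraph k X).toLinearPMap

lemma atSite_graph {N : ℕ} (k : Fin N) (X : SiteSpace →ₗ.[ℂ] SiteSpace) :
    (atSite k X).graph = atSiteGraph k X := by
  refine Submodule.toLinearPMap_graph_eq _ fun z hz h0 => ?_
  simp only [atSiteGraph, Submodule.mem_iInf, Submodule.mem_comap, LinearMap.prodMap_apply,
    h0, map_zero] at hz
  ext m
  have h1 : slice k m z.2 = 0 := X.graph_fst_eq_zero_snd (hz m) rfl
  have h2 : insertSite k m (fun α => m (k, α)) = m := by
    funext i
    obtain ⟨j, α⟩ := i
    by_cases hj : j = k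
    · subst hj
      simp [insertSite]
    · simp [insertSite, hj]
  have h3 := congrArg (fun v : SiteSpace => v (fun α => m (k, α))) h1
  change z.2 (insertSite k m (fun α => m (k, α))) = 0 at h3
  rw [h2] at h3
  simpa using h3

/-- The mean-field operator `X^{(N)} = (1/N) ∑_k X^{[k]}`. -/
def meanField (N : ℕ) (X : SiteSpace →ₗ.[ℂ] SiteSpace) : ChainSpace N →ₗ.[ℂ] ChainSpace N :=
  (N : ℂ)⁻¹ • ∑ k : Fin N, atSite k X

end OscillatorChain

end

/-!
A one-site observable `X` has a self-adjoint closure, so by Stone's theorem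
(`exists_isUnitaryGroupOf`, proved with bounded approximations built from resolvents) it generates
a unitary group `e^{itX}`. The mean-field operator `X^{(N)}` is `1 / N` times a sum of commuting
copies of `X` acting at different sites, and its exponential is the tensor power
`e^{iX/N} ⊗ ⋯ ⊗ e^{iX/N}` (`unitaryExp_eq_tensorPow`). Two facts give this. The tensor power is a
unitary group whose generator extends `X^{(N)}`, which reduces to one site by taking partial inner
products with number states of the other sites (`hasOrbitDeriv_lift`). Moreover it is the only
such group: generators are closed, so the generator of any other one agrees with it on product
vectors over the domain of the closure of `X`, and these are total and invariant under the tensor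
power (`IsUnitaryGroupOf.eq_tensorPow`). The same argument covers `∑ⱼ Xⱼ^{(N)}`, whose domain
still contains enough product vectors (`unitaryExp_sum_meanField`).

Since the Gibbs weights factorize over the sites (`gibbsWeight_eq_prod`), the expectation of a
tensor power is the `N`-th power of a one-site expectation (`boundedExpectation_tensorPow`). The
latter is `⟨e^{iX₁/N} ⋯ e^{iXₙ/N}⟩ = 1 + i ∑ⱼ ⟨Xⱼ⟩ / N + o(1 / N)`: every number state `|a⟩` lies
in the domains of the `Xⱼ`, and `N ‖e^{iX₁/N} ⋯ e^{iXₙ/N} |a⟩ - |a⟩‖ ≤ ∑ⱼ ‖Xⱼ |a⟩‖` dominates the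
sum over `a`, because finite second moments bound the first moments. The limit is then that of
`(1 + z / N) ^ N` (`tendsto_boundedExpectation_tensorPow`).
-/

namespace OscillatorChain

/-! ### One-parameter unitary groups -/

/-- Strongly continuous one-parameter unitary groups, without reference to a generator. -/
structure IsUnitaryGroup {E : Type*} [NormedAddCommGroup E] [InnerProductSpace ℂ E]
    [CompleteSpace E] (U : ℝ → E →L[ℂ] E) : Prop where
  map_zero : U 0 = 1
  map_add : ∀ s t : ℝ, U (s + t) = U s * U t
  mem_unitary : ∀ t : ℝ, U t ∈ unitary (E →L[ℂ] E)
  continuous : ∀ ψ : E, Continuous fun t : ℝ => U t ψ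

section UnitaryGroup

variable {E : Type*} [NormedAddCommGroup E] [InnerProductSpace ℂ E] [CompleteSpace E]

/-- The orbit of `ψ` under `U` has the strong derivative `χ` at time zero.  On a space of complex
functions this fixes the real scalar multiplication entering the derivative to be the one obtained
by restricting the complex scalars. -/
def HasOrbitDeriv (U : ℝ → E →L[ℂ] E) (ψ χ : E) : Prop := HasDerivAt (fun t => U t ψ) χ 0

lemma IsUnitaryGroupOf.isUnitaryGroup {A : E →ₗ.[ℂ] E} {U : ℝ → E →L[ℂ] E}
    (h : IsUnitaryGroupOf A U) : IsUnitaryGroup U :=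
  ⟨h.map_zero, h.map_add, h.mem_unitary, h.continuous⟩

lemma IsUnitaryGroupOf.hasOrbitDeriv_of_mem_graph {A : E →ₗ.[ℂ] E} {U : ℝ → E →L[ℂ] E}
    (h : IsUnitaryGroupOf A U) {ψ χ : E} (hp : (ψ, χ) ∈ A.graph) :
    HasOrbitDeriv U ψ (Complex.I • χ) := by
  obtain ⟨y, hy1, hy2⟩ := (LinearPMap.mem_graph_iff A).1 hp
  have := h.hasDerivAt y
  simp only at hy1 hy2
  rwa [hy1, hy2] at this

lemma IsUnitaryGroup.isUnitaryGroupOf {A : E →ₗ.[ℂ] E} {U : ℝ → E →L[ℂ] E}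
    (h : IsUnitaryGroup U)
    (hd : ∀ ψ χ : E, (ψ, χ) ∈ A.graph → HasOrbitDeriv U ψ (Complex.I • χ)) :
    IsUnitaryGroupOf A U :=
  ⟨h.map_zero, h.map_add, h.mem_unitary, h.continuous, fun ψ => hd _ _ (A.mem_graph ψ)⟩

lemma IsUnitaryGroupOf.mono {A B : E →ₗ.[ℂ] E} {U : ℝ → E →L[ℂ] E}
    (h : IsUnitaryGroupOf B U) (hAB : A.graph ≤ B.graph) : IsUnitaryGroupOf A U :=
  h.isUnitaryGroup.isUnitaryGroupOf fun _ _ hp => h.hasOrbitDeriv_of_mem_graph (hAB hp)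

namespace IsUnitaryGroup

lemma of_norm_apply {U : ℝ → E →L[ℂ] E} (map_zero : U 0 = 1)
    (map_add : ∀ s t : ℝ, U (s + t) = U s * U t) (norm_apply : ∀ t ψ, ‖U t ψ‖ = ‖ψ‖)
    (continuous : ∀ ψ : E, Continuous fun t : ℝ => U t ψ) : IsUnitaryGroup U := by
  have hstar : ∀ t, star (U t) = U (-t) := by
    intro t
    refine ((ContinuousLinearMap.eq_adjoint_iff _ _).2 fun x y => ?_).symm
    have h1 := (LinearMap.norm_map_iff_inner_map_map (U t)).1 (norm_apply t) (U (-t) x) y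
    rw [← mul_apply_eq_comp, ← map_add, add_neg_cancel, map_zero] at h1
    exact h1.symm
  refine ⟨map_zero, map_add, fun t => ?_, continuous⟩
  rw [Unitary.mem_iff, hstar, ← map_add, ← map_add, neg_add_cancel, add_neg_cancel, map_zero]
  exact ⟨rfl, rfl⟩

variable {U : ℝ → E →L[ℂ] E} (hU : IsUnitaryGroup U)
include hU

lemma apply_add (s t : ℝ) (ψ : E) : U (s + t) ψ = U s (U t ψ) := by
  rw [hU.map_add]; rfl

lemma apply_zero (ψ : E) : U 0 ψ = ψ := by
  rw [hU.map_zero]; rfl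

lemma norm_apply (t : ℝ) (ψ : E) : ‖U t ψ‖ = ‖ψ‖ :=
  Unitary.norm_map ⟨U t, hU.mem_unitary t⟩ ψ

lemma apply_apply_neg (t : ℝ) (ψ : E) : U t (U (-t) ψ) = ψ := by
  rw [← hU.apply_add, add_neg_cancel, hU.apply_zero]

lemma inner_apply_left (t : ℝ) (ψ φ : E) : ⟪U t ψ, φ⟫ = ⟪ψ, U (-t) φ⟫ := by
  conv_lhs => rw [← hU.apply_apply_neg t φ]
  exact Unitary.inner_map_map ⟨U t, hU.mem_unitary t⟩ ψ _

lemma comp_mul (c : ℝ) : IsUnitaryGroup fun t => U (c * t) where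
  map_zero := by rw [mul_zero, hU.map_zero]
  map_add s t := by rw [mul_add, hU.map_add]
  mem_unitary t := hU.mem_unitary _
  continuous ψ := (hU.continuous ψ).comp (continuous_const.mul continuous_id)

lemma tendsto_apply {l : Filter ℝ} {f : ℝ → E} {t₀ : ℝ} {φ : E} (hl : Tendsto id l (𝓝 t₀))
    (hf : Tendsto f l (𝓝 φ)) : Tendsto (fun t => U t (f t)) l (𝓝 (U t₀ φ)) := by
  have h1 : Tendsto (fun t => U t φ) l (𝓝 (U t₀ φ)) := ((hU.continuous φ).tendsto t₀).comp hl
  have h2 : Tendsto (fun t => U t (f t - φ)) l (𝓝 0) := by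
    rw [tendsto_zero_iff_norm_tendsto_zero]
    simp only [hU.norm_apply]
    rw [← tendsto_zero_iff_norm_tendsto_zero]
    simpa using hf.sub_const φ
  simpa using h2.add h1

/-- Product rule at time zero; only the strong derivative of `U` at the single vector `f 0` is
needed, since the operators `U t` are isometric. -/
lemma hasDerivAt_apply {f : ℝ → E} {f' w : E} (hf : HasDerivAt f f' 0)
    (hw : HasOrbitDeriv U (f 0) w) :
    HasDerivAt (fun t => U t (f t)) (w + f') 0 := by
  unfold HasOrbitDeriv at hw
  rw [hasDerivAt_iff_tendsto_slope_zero] at hf hw ⊢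
  have h := hU.tendsto_apply (tendsto_id.mono_left nhdsWithin_le_nhds) hf
  rw [hU.apply_zero] at h
  refine (hw.add h).congr fun t => ?_
  have h1 : U t (t⁻¹ • (f t - f 0)) = t⁻¹ • U t (f t - f 0) :=
    ((U t).restrictScalars ℝ).map_smul _ _
  simp only [zero_add, hU.apply_zero]
  rw [h1, ← smul_add, map_sub]
  congr 1
  abel

lemma hasDerivAt_of_hasOrbitDeriv {ψ χ : E} (h : HasOrbitDeriv U ψ χ) (t : ℝ) :
    HasDerivAt (fun s => U s ψ) (U t χ) t := by
  have h1 : HasDerivAt (fun s => U (s - t) ψ) χ t := by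
    have := HasDerivAt.comp_sub_const (f := fun s => U s ψ) (f' := χ) t t (by rwa [sub_self])
    exact this
  have h2 := ((U t).restrictScalars ℝ).hasFDerivAt.comp_hasDerivAt t h1
  refine h2.congr_of_eventuallyEq (Eventually.of_forall fun s => ?_)
  simp only [Function.comp, ContinuousLinearMap.coe_restrictScalars']
  rw [← hU.apply_add, add_sub_cancel]

/-- Membership in the generator as an integral equation, which is stable under limits and under
bounded operators. -/
lemma hasOrbitDeriv_iff {ψ χ : E} :
    HasOrbitDeriv U ψ χ ↔ ∀ t, U t ψ - ψ = ∫ s in (0 : ℝ)..t, U s χ := by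
  constructor
  · intro h t
    rw [intervalIntegral.integral_eq_sub_of_hasDerivAt
      (fun s _ => hU.hasDerivAt_of_hasOrbitDeriv h s)
      ((hU.continuous χ).intervalIntegrable _ _), hU.apply_zero]
  · intro h
    have h1 := ((hU.continuous χ).integral_hasStrictDerivAt 0 0).hasDerivAt.add_const ψ
    rw [hU.apply_zero] at h1
    exact h1.congr_of_eventuallyEq (Eventually.of_forall fun t => by
      simp only [← h t, sub_add_cancel])

lemma norm_integral_le (χ : E) (t : ℝ) : ‖∫ s in (0 : ℝ)..t, U s χ‖ ≤ ‖χ‖ * |t| := by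
  simpa using intervalIntegral.norm_integral_le_of_norm_le_const (a := 0) (b := t)
    fun s _ => (hU.norm_apply s χ).le

lemma norm_apply_sub_le {ψ χ : E} (h : HasOrbitDeriv U ψ χ) (t : ℝ) :
    ‖U t ψ - ψ‖ ≤ ‖χ‖ * |t| := by
  rw [hU.hasOrbitDeriv_iff.1 h t]
  exact hU.norm_integral_le χ t

/-- The generator of a strongly continuous unitary group has closed graph. -/
lemma isClosed_generator : IsClosed {p : E × E | HasOrbitDeriv U p.1 p.2} := by
  simp only [hU.hasOrbitDeriv_iff, Set.ofPred_forall]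
  refine isClosed_iInter fun t => isClosed_eq (by fun_prop) ?_
  have hl : LipschitzWith ‖t‖₊ fun χ : E => ∫ s in (0 : ℝ)..t, U s χ := by
    refine LipschitzWith.of_dist_le_mul fun χ χ' => ?_
    rw [dist_eq_norm, dist_eq_norm, ← intervalIntegral.integral_sub
      ((hU.continuous χ).intervalIntegrable _ _) ((hU.continuous χ').intervalIntegrable _ _)]
    simp only [← map_sub]
    rw [mul_comm]
    exact hU.norm_integral_le _ t
  exact hl.continuous.comp continuous_snd

omit hU in
/-- Two unitary groups `U` and `V` agree on a vector `ψ` if along the whole orbit of `ψ` under `V`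
their generators agree, because then `U (-t) V t ψ` has derivative zero. -/
lemma apply_eq_of_orbit {V : ℝ → E →L[ℂ] E} (hU : IsUnitaryGroup U) (hV : IsUnitaryGroup V)
    {ψ χ : E} (hVψ : HasOrbitDeriv V ψ χ)
    (hUψ : ∀ s, HasOrbitDeriv U (V s ψ) (V s χ)) (t : ℝ) : U t ψ = V t ψ := by
  have hd : ∀ t, HasDerivAt (fun t => U (-t) (V t ψ)) 0 t := by
    intro t
    have hUn : IsUnitaryGroup fun t => U (-t) := by simpa using hU.comp_mul (-1)
    have h1 : HasDerivAt (fun h => V (t + h) ψ) (V t χ) 0 := by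
      have := HasDerivAt.comp_const_add (f := fun s => V s ψ) (f' := V t χ) t 0
        (by rw [add_zero]; exact hV.hasDerivAt_of_hasOrbitDeriv hVψ t)
      exact this
    have h2 : HasDerivAt (fun h => U (-h) (V (t + 0) ψ)) (-(V t χ)) 0 := by
      have := HasDerivAt.scomp (𝕜 := ℝ) (𝕜' := ℝ) (0 : ℝ) (h := fun h : ℝ => -h)
        (g₁ := fun h => U h (V t ψ)) (by rw [neg_zero]; exact hUψ t) (hasDerivAt_neg (0 : ℝ))
      simpa [Function.comp_def] using this
    have h3 := hUn.hasDerivAt_apply h1 h2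
    rw [neg_add_cancel] at h3
    have h4 := ((U (-t)).restrictScalars ℝ).hasFDerivAt.comp_hasDerivAt 0 h3
    have h5 : HasDerivAt (fun h => U (-(t + h)) (V (t + h) ψ)) 0 0 := by
      refine (h4.congr_deriv (by simp)).congr_of_eventuallyEq (Eventually.of_forall fun h => ?_)
      simp only [Function.comp, ContinuousLinearMap.coe_restrictScalars']
      rw [neg_add, hU.apply_add]
    have h6 := HasDerivAt.comp_sub_const (f := fun h => U (-(t + h)) (V (t + h) ψ)) (f' := 0) t t
      (by rwa [sub_self])
    simpa using h6
  have hc := is_const_of_deriv_eq_zero (fun t => (hd t).differentiableAt) (fun t => (hd t).deriv)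
    t 0
  simp only [neg_zero, hU.apply_zero, hV.apply_zero] at hc
  rw [← hU.apply_apply_neg t (V t ψ), hc]

end IsUnitaryGroup

omit [CompleteSpace E] in
lemma HasOrbitDeriv.comp_mul {U : ℝ → E →L[ℂ] E} {ψ χ : E} (h : HasOrbitDeriv U ψ χ) (c : ℝ) :
    HasOrbitDeriv (fun t => U (c * t)) ψ ((c : ℂ) • χ) := by
  have h1 := HasDerivAt.scomp (𝕜 := ℝ) (𝕜' := ℝ) (0 : ℝ) (h := fun t : ℝ => c * t)
    (g₁ := fun t => U t ψ) (h' := c) (by rw [mul_zero]; exact h)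
    (by simpa using (hasDerivAt_id (0 : ℝ)).const_mul c)
  exact h1

omit [CompleteSpace E] in
lemma HasOrbitDeriv.tendsto_natCast_smul {U : ℝ → E →L[ℂ] E} {ψ χ : E} (h : HasOrbitDeriv U ψ χ)
    (h0 : U 0 = 1) :
    Tendsto (fun N : ℕ => (N : ℂ) • (U (N : ℝ)⁻¹ ψ - ψ)) atTop (𝓝 χ) := by
  have h1 := hasDerivAt_iff_tendsto_slope_zero.1 h
  have h2 : Tendsto (fun N : ℕ => (N : ℝ)⁻¹) atTop (𝓝[≠] 0) :=
    tendsto_nhdsWithin_iff.2 ⟨tendsto_inv_atTop_nhds_zero_nat,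
      (eventually_ne_atTop 0).mono fun N hN => inv_ne_zero (Nat.cast_ne_zero.2 hN)⟩
  refine (h1.comp h2).congr fun N => ?_
  simp only [Function.comp, inv_inv, zero_add, h0]
  exact (Nat.cast_smul_eq_nsmul ℝ N _).trans (Nat.cast_smul_eq_nsmul ℂ N _).symm

/-- Differentiability of an orbit can be tested after applying a separating family of bounded
operators that intertwine two unitary groups, because it is equivalent to an integral equation. -/
lemma IsUnitaryGroup.hasOrbitDeriv_of_intertwine {F : Type*} [NormedAddCommGroup F]
    [InnerProductSpace ℂ F] [CompleteSpace F] {U : ℝ → E →L[ℂ] E} {V : ℝ → F →L[ℂ] F}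
    (hU : IsUnitaryGroup U) (hV : IsUnitaryGroup V) {κ : Type*} {S : κ → E →L[ℂ] F}
    (hS : ∀ x y, (∀ m, S m x = S m y) → x = y) (hUV : ∀ m t x, S m (U t x) = V t (S m x))
    {ψ χ : E} (h : ∀ m, HasOrbitDeriv V (S m ψ) (S m χ)) : HasOrbitDeriv U ψ χ := by
  rw [hU.hasOrbitDeriv_iff]
  intro t
  refine hS _ _ fun m => ?_
  rw [map_sub, hUV, hV.hasOrbitDeriv_iff.1 (h m) t,
    ← (S m).intervalIntegral_comp_comm ((hU.continuous χ).intervalIntegrable 0 t)]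
  simp only [hUV]

lemma list_prod_map_zero {ι : Type*} {W : ι → ℝ → E →L[ℂ] E} (hW : ∀ i, IsUnitaryGroup (W i))
    (L : List ι) : (L.map fun i => W i 0).prod = 1 := by
  refine List.prod_eq_one fun x hx => ?_
  obtain ⟨i, -, rfl⟩ := List.mem_map.1 hx
  exact (hW i).map_zero

/-- The generators of the factors add up at time zero, whether or not the groups commute. -/
lemma hasOrbitDeriv_list_prod {ι : Type*} {W : ι → ℝ → E →L[ℂ] E} (hW : ∀ i, IsUnitaryGroup (W i))
    {ψ : E} {χ : ι → E} (h : ∀ i, HasOrbitDeriv (W i) ψ (χ i)) (L : List ι) :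
    HasOrbitDeriv (fun t => (L.map fun i => W i t).prod) ψ (L.map χ).sum := by
  induction L with
  | nil => simpa [HasOrbitDeriv] using hasDerivAt_const (0 : ℝ) ψ
  | cons i L ih =>
    simp only [List.map_cons, List.prod_cons, List.sum_cons]
    refine (hW i).hasDerivAt_apply ih ?_
    rw [list_prod_map_zero hW]
    exact h i

lemma norm_list_prod_sub_le {ι : Type*} {W : ι → ℝ → E →L[ℂ] E} (hW : ∀ i, IsUnitaryGroup (W i))
    {ψ : E} {χ : ι → E} (h : ∀ i, HasOrbitDeriv (W i) ψ (χ i)) (L : List ι) (t : ℝ) :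
    ‖(L.map fun i => W i t).prod ψ - ψ‖ ≤ (L.map fun i => ‖χ i‖).sum * |t| := by
  induction L with
  | nil => simp
  | cons i L ih =>
    simp only [List.map_cons, List.prod_cons, List.sum_cons, mul_apply_eq_comp]
    set φ := (L.map fun i => W i t).prod ψ
    calc ‖W i t φ - ψ‖ = ‖(W i t ψ - ψ) + W i t (φ - ψ)‖ := by rw [map_sub]; congr 1; abel
      _ ≤ ‖χ i‖ * |t| + ‖φ - ψ‖ := by
        refine (norm_add_le _ _).trans (add_le_add ((hW i).norm_apply_sub_le (h i) t) ?_)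
        rw [(hW i).norm_apply]
      _ ≤ _ := by rw [add_mul]; gcongr

lemma mem_graph_iff_of_isSelfAdjoint {A : E →ₗ.[ℂ] E} (hA : IsSelfAdjoint A) {φ η : E} :
    (φ, η) ∈ A.graph ↔ ∀ a b : E, (a, b) ∈ A.graph → ⟪b, φ⟫ = ⟪a, η⟫ := by
  have h := LinearPMap.adjoint_graph_eq_graph_adjoint (T := A) hA.dense_domain
  rw [LinearPMap.isSelfAdjoint_def.1 hA] at h
  conv_lhs => rw [h]
  rw [Submodule.mem_adjoint_iff]
  simp only [sub_eq_zero]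

/-- The unitary group of a self-adjoint operator commutes with the operator; in particular it
leaves the domain invariant. -/
lemma IsUnitaryGroupOf.apply_mem_graph {A : E →ₗ.[ℂ] E} (hA : IsSelfAdjoint A)
    {U : ℝ → E →L[ℂ] E} (hU : IsUnitaryGroupOf A U) (t : ℝ) {φ η : E} (h : (φ, η) ∈ A.graph) :
    (U t φ, U t η) ∈ A.graph := by
  have hG := hU.isUnitaryGroup
  rw [mem_graph_iff_of_isSelfAdjoint hA]
  intro a b hab
  -- Both sides are, up to the factor `-i`, the derivative at `0` of `s ↦ ⟪U s a, U t φ⟫`.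
  have h1 : HasDerivAt (fun s => ⟪U s a, U t φ⟫) (-Complex.I * ⟪b, U t φ⟫) 0 := by
    have := (hU.hasOrbitDeriv_of_mem_graph hab).inner ℂ (hasDerivAt_const (0 : ℝ) (U t φ))
    simpa [inner_smul_left] using this
  have h2 : HasDerivAt (fun s => ⟪U s a, U t φ⟫) (-Complex.I * ⟪a, U t η⟫) 0 := by
    have h3 : HasDerivAt (fun s => U (-s) φ) (-(Complex.I • η)) 0 := by
      have := HasDerivAt.scomp (𝕜 := ℝ) (𝕜' := ℝ) (0 : ℝ) (h := fun h : ℝ => -h)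
        (g₁ := fun h => U h φ) (by rw [neg_zero]; exact hU.hasOrbitDeriv_of_mem_graph h)
        (hasDerivAt_neg (0 : ℝ))
      simpa [Function.comp_def] using this
    have h4 := (hasDerivAt_const (0 : ℝ) (U (-t) a)).inner ℂ h3
    refine (h4.congr_deriv ?_).congr_of_eventuallyEq (Eventually.of_forall fun s => ?_)
    · have := hG.inner_apply_left (-t) a η
      rw [neg_neg] at this
      simp [inner_smul_right, this]
    · simp only
      rw [hG.inner_apply_left, hG.inner_apply_left, neg_neg, ← hG.apply_add, ← hG.apply_add,
        add_comm]
  exact mul_left_cancel₀ (neg_ne_zero.2 Complex.I_ne_zero) (h1.unique h2)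

end UnitaryGroup

/-! ### Stone's theorem: a self-adjoint operator generates a unitary group -/

section Stone

variable {E : Type*} [NormedAddCommGroup E] [InnerProductSpace ℂ E] [CompleteSpace E]

omit [CompleteSpace E] in
lemma continuous_apply_of_dense {U : ℝ → E →L[ℂ] E} (hU : ∀ t ψ, ‖U t ψ‖ ≤ ‖ψ‖) {D : Set E}
    (hD : Dense D) (hc : ∀ ψ ∈ D, Continuous fun t => U t ψ) (ψ : E) :
    Continuous fun t => U t ψ := by
  refine continuous_of_uniform_approx_of_continuous fun u hu => ?_
  obtain ⟨ε, hε, hu⟩ := Metric.mem_uniformity_dist.1 hu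
  obtain ⟨φ, hφ, hd⟩ := hD.exists_dist_lt ψ hε
  refine ⟨fun t => U t φ, hc φ hφ, fun t => hu ?_⟩
  rw [dist_eq_norm] at hd ⊢
  rw [← map_sub]
  exact (hU t _).trans_lt hd

lemma isUnitaryGroup_exp {B : E →L[ℂ] E} (hB : IsSelfAdjoint B) :
    IsUnitaryGroup fun t : ℝ => NormedSpace.exp (t • (Complex.I • B)) where
  map_zero := by simp
  map_add s t := by
    let _ : NormedAlgebra ℚ (E →L[ℂ] E) := NormedAlgebra.restrictScalars ℚ ℂ _
    rw [add_smul, NormedSpace.exp_add_of_commute]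
    exact ((Commute.refl (Complex.I • B)).smul_left s).smul_right t
  mem_unitary t := by
    let _ : NormedAlgebra ℚ (E →L[ℂ] E) := NormedAlgebra.restrictScalars ℚ ℂ _
    refine NormedSpace.exp_mem_unitary_of_mem_skewAdjoint ?_
    rw [skewAdjoint.mem_iff, star_smul, star_smul, hB.star_eq]
    simp
  continuous ψ := by
    have h : Continuous fun t : ℝ => NormedSpace.exp (t • (Complex.I • B)) :=
      continuous_iff_continuousAt.2 fun t => (hasDerivAt_exp_smul_const _ t).continuousAt
    fun_prop

lemma hasOrbitDeriv_exp (B : E →L[ℂ] E) (ψ : E) :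
    HasOrbitDeriv (fun t : ℝ => NormedSpace.exp (t • (Complex.I • B))) ψ (Complex.I • B ψ) := by
  have h := hasDerivAt_exp_smul_const (Complex.I • B) (0 : ℝ)
  have h2 := ((ContinuousLinearMap.apply ℂ E ψ).restrictScalars ℝ).hasFDerivAt.comp_hasDerivAt 0 h
  simpa [HasOrbitDeriv, Function.comp_def] using h2

lemma norm_exp_sub_exp_apply_le {B C : E →L[ℂ] E} (hB : IsSelfAdjoint B) (hC : IsSelfAdjoint C)
    (hBC : Commute B C) (t : ℝ) (ψ : E) :
    ‖NormedSpace.exp (t • (Complex.I • B)) ψ - NormedSpace.exp (t • (Complex.I • C)) ψ‖ ≤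
      ‖B ψ - C ψ‖ * |t| := by
  let _ : NormedAlgebra ℚ (E →L[ℂ] E) := NormedAlgebra.restrictScalars ℚ ℂ _
  have h1 : NormedSpace.exp (t • (Complex.I • B)) = NormedSpace.exp (t • (Complex.I • C)) *
      NormedSpace.exp (t • (Complex.I • (B - C))) := by
    rw [← NormedSpace.exp_add_of_commute]
    · congr 1
      rw [← smul_add, ← smul_add, add_sub_cancel]
    · exact (((hBC.symm.sub_right (Commute.refl C)).smul_left _).smul_right _).smul_left t
        |>.smul_right t
  rw [h1, mul_apply_eq_comp, ← map_sub, (isUnitaryGroup_exp hC).norm_apply]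
  refine ((isUnitaryGroup_exp (hB.sub hC)).norm_apply_sub_le
    (hasOrbitDeriv_exp (B - C) ψ) t).trans_eq ?_
  rw [norm_smul, Complex.norm_I, one_mul]
  rfl

/-- If commuting bounded self-adjoint operators converge strongly to `A` on the domain of `A`,
then their exponentials converge strongly to a unitary group whose generator extends `A`. -/
lemma exists_isUnitaryGroupOf_of_tendsto {A : E →ₗ.[ℂ] E} (hA : Dense (A.domain : Set E))
    {B : ℕ → E →L[ℂ] E} (hB : ∀ n, IsSelfAdjoint (B n)) (hc : ∀ m n, Commute (B m) (B n))
    (hlim : ∀ ψ χ, (ψ, χ) ∈ A.graph → Tendsto (fun n => B n ψ) atTop (𝓝 χ)) :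
    ∃ U : ℝ → E →L[ℂ] E, IsUnitaryGroupOf A U := by
  set W : ℕ → ℝ → E →L[ℂ] E := fun n t => NormedSpace.exp (t • (Complex.I • B n)) with hWdef
  have hW : ∀ n, IsUnitaryGroup (W n) := fun n => isUnitaryGroup_exp (hB n)
  have hcauchy : ∀ t ψ, CauchySeq fun n => W n t ψ := by
    intro t ψ
    rw [Metric.cauchySeq_iff]
    intro ε hε
    obtain ⟨φ, hφ, hd⟩ := hA.exists_dist_lt ψ (show 0 < ε / 3 by positivity)
    have h1 := (hlim φ _ (A.mem_graph ⟨φ, hφ⟩)).cauchySeq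
    obtain ⟨M, hM⟩ := Metric.cauchySeq_iff.1 h1 (ε / (3 * (|t| + 1))) (by positivity)
    refine ⟨M, fun m hm n hn => ?_⟩
    have h2 : dist (W m t φ) (W n t φ) < ε / 3 := by
      have h3 := hM m hm n hn
      rw [dist_eq_norm] at h3 ⊢
      refine (norm_exp_sub_exp_apply_le (hB m) (hB n) (hc m n) t φ).trans_lt ?_
      have h4 := mul_le_mul_of_nonneg_left (show |t| ≤ |t| + 1 by linarith)
        (norm_nonneg (B m φ - B n φ))
      refine h4.trans_lt ?_
      rw [lt_div_iff₀ (by positivity)] at h3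
      linarith
    have h5 : ∀ k, dist (W k t ψ) (W k t φ) < ε / 3 := fun k => by
      rw [dist_eq_norm, ← map_sub, (hW k).norm_apply, ← dist_eq_norm]
      exact hd
    calc dist (W m t ψ) (W n t ψ) ≤ dist (W m t ψ) (W m t φ) + dist (W m t φ) (W n t φ) +
          dist (W n t φ) (W n t ψ) := dist_triangle4 _ _ _ _
      _ < ε / 3 + ε / 3 + ε / 3 := by
        refine add_lt_add (add_lt_add (h5 m) h2) ?_
        rw [dist_comm]
        exact h5 n
      _ = ε := by ring
  choose u hu using fun t ψ => cauchySeq_tendsto_of_complete (hcauchy t ψ)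
  let U : ℝ → E →L[ℂ] E := fun t => continuousLinearMapOfTendsto (fun n => W n t)
    (tendsto_pi_nhds.2 (hu t))
  have hlimU : ∀ t ψ, Tendsto (fun n => W n t ψ) atTop (𝓝 (U t ψ)) := hu
  have hnorm : ∀ t ψ, ‖U t ψ‖ = ‖ψ‖ := fun t ψ =>
    tendsto_nhds_unique (hlimU t ψ).norm (by
      simp only [(hW _).norm_apply]
      exact tendsto_const_nhds)
  have hzero : U 0 = 1 := by
    ext ψ
    refine tendsto_nhds_unique (hlimU 0 ψ) ?_
    simp only [(hW _).apply_zero]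
    exact tendsto_const_nhds
  have hadd : ∀ s t, U (s + t) = U s * U t := by
    intro s t
    ext ψ
    refine tendsto_nhds_unique (hlimU (s + t) ψ) ?_
    have h1 : Tendsto (fun n => W n s (W n t ψ - U t ψ)) atTop (𝓝 0) := by
      rw [tendsto_zero_iff_norm_tendsto_zero]
      simp only [(hW _).norm_apply]
      rw [← tendsto_zero_iff_norm_tendsto_zero]
      simpa using (hlimU t ψ).sub_const (U t ψ)
    simpa [(hW _).apply_add] using h1.add (hlimU s (U t ψ))
  have hcont : ∀ ψ, Continuous fun t => U t ψ := by
    refine continuous_apply_of_dense (fun t ψ => (hnorm t ψ).le) hA fun ψ hψ => ?_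
    have hl : LipschitzWith ‖A ⟨ψ, hψ⟩‖₊ fun t => U t ψ := by
      refine LipschitzWith.of_dist_le_mul fun t s => ?_
      have h1 := (hlimU (t - s) ψ).sub_const ψ |>.norm
      have h2 : ‖U (t - s) ψ - ψ‖ ≤ ‖A ⟨ψ, hψ⟩‖ * |t - s| := by
        refine le_of_tendsto_of_tendsto' h1
          ((hlim ψ _ (A.mem_graph ⟨ψ, hψ⟩)).norm.mul_const |t - s|) fun n => ?_
        refine ((hW n).norm_apply_sub_le (hasOrbitDeriv_exp (B n) ψ) _).trans_eq ?_
        rw [norm_smul, Complex.norm_I, one_mul]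
      have h3 : U t ψ - U s ψ = U s (U (t - s) ψ - ψ) := by
        rw [map_sub, ← mul_apply_eq_comp, ← hadd, add_sub_cancel]
      rw [dist_eq_norm, h3, hnorm]
      exact h2
    exact hl.continuous
  have hU : IsUnitaryGroup U := .of_norm_apply hzero hadd hnorm hcont
  refine ⟨U, hU.isUnitaryGroupOf fun ψ χ hp => hU.hasOrbitDeriv_iff.2 fun t => ?_⟩
  refine tendsto_nhds_unique ((hlimU t ψ).sub_const ψ) ?_
  have hBψ := (hlim ψ χ hp).const_smul Complex.I
  obtain ⟨C, hC⟩ := hBψ.norm.bddAbove_range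
  simp only [(hW _).hasOrbitDeriv_iff.1 (hasOrbitDeriv_exp (B _) ψ) t]
  refine intervalIntegral.tendsto_integral_filter_of_dominated_convergence (fun _ => C)
    (Eventually.of_forall fun n => ((hW n).continuous _).aestronglyMeasurable)
    (Eventually.of_forall fun n => Eventually.of_forall fun s _ => ?_)
    intervalIntegrable_const (Eventually.of_forall fun s _ => ?_)
  · rw [(hW n).norm_apply]
    exact hC ⟨n, rfl⟩
  · have h1 : Tendsto (fun n => W n s (Complex.I • B n ψ - Complex.I • χ)) atTop (𝓝 0) := by
      rw [tendsto_zero_iff_norm_tendsto_zero]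
      simp only [(hW _).norm_apply]
      rw [← tendsto_zero_iff_norm_tendsto_zero]
      simpa using hBψ.sub_const (Complex.I • χ)
    simpa using h1.add (hlimU s (Complex.I • χ))

/-- `A + ic` is bounded below by `|c|`, because `⟪ψ, A ψ⟫` is real. -/
lemma norm_le_of_mem_graph {A : E →ₗ.[ℂ] E} (hA : IsSelfAdjoint A) (c : ℝ) {ψ χ : E}
    (hp : (ψ, χ) ∈ A.graph) : |c| * ‖ψ‖ ≤ ‖χ + (Complex.I * c) • ψ‖ := by
  have hreal : (⟪ψ, χ⟫).im = 0 := by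
    have h1 : ⟪χ, ψ⟫ = ⟪ψ, χ⟫ := (mem_graph_iff_of_isSelfAdjoint hA).1 hp ψ χ hp
    rw [← inner_conj_symm] at h1
    exact Complex.conj_eq_iff_im.1 h1
  have him : (⟪ψ, χ + (Complex.I * c) • ψ⟫).im = c * (‖ψ‖ * ‖ψ‖) := by
    rw [inner_add_right, inner_smul_right, inner_self_eq_norm_sq_to_K, Complex.add_im, hreal]
    simp [-Complex.ofReal_pow, sq]
  rcases (norm_nonneg ψ).eq_or_lt with h0 | h0
  · rw [← h0, mul_zero]
    exact norm_nonneg _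
  · have h2 : |c| * (‖ψ‖ * ‖ψ‖) ≤ ‖ψ‖ * ‖χ + (Complex.I * c) • ψ‖ := by
      rw [← abs_of_nonneg (mul_self_nonneg ‖ψ‖), ← abs_mul, ← him]
      exact (Complex.abs_im_le_norm _).trans (norm_inner_le_norm _ _)
    refine le_of_mul_le_mul_left ?_ h0
    linarith

/-- The resolvent `(A + ic)⁻¹` of a self-adjoint operator is everywhere defined and bounded by
`1 / |c|`. -/
lemma exists_resolvent {A : E →ₗ.[ℂ] E} (hA : IsSelfAdjoint A) {c : ℝ} (hc : c ≠ 0) :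
    ∃ R : E →L[ℂ] E, (∀ φ, (R φ, φ - (Complex.I * c) • R φ) ∈ A.graph) ∧
      ∀ φ, |c| * ‖R φ‖ ≤ ‖φ‖ := by
  have hc' : 0 < |c| := abs_pos.2 hc
  let L : A.graph →L[ℂ] E := (ContinuousLinearMap.snd ℂ E E + (Complex.I * c) •
    ContinuousLinearMap.fst ℂ E E).comp A.graph.subtypeL
  have hLapp : ∀ p : A.graph, L p = p.1.2 + (Complex.I * c) • p.1.1 := fun p => rfl
  have hbound : ∀ p : A.graph, |c| * ‖p.1.1‖ ≤ ‖L p‖ := fun p => norm_le_of_mem_graph hA c p.2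
  have hanti : AntilipschitzWith (Real.toNNReal (1 / |c| + 2)) L := by
    refine L.antilipschitz_of_bound fun p => ?_
    rw [Real.coe_toNNReal _ (by positivity)]
    have h1 : ‖p.1.1‖ ≤ 1 / |c| * ‖L p‖ := by
      rw [div_mul_eq_mul_div, one_mul, le_div_iff₀ hc', mul_comm]
      exact hbound p
    have h2 : ‖p.1.2‖ ≤ 2 * ‖L p‖ := by
      have h3 : p.1.2 = L p - (Complex.I * c) • p.1.1 := by rw [hLapp, add_sub_cancel_right]
      have h4 := norm_sub_le (L p) ((Complex.I * c) • p.1.1)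
      rw [← h3, norm_smul, norm_mul, Complex.norm_I, one_mul, Complex.norm_real,
        Real.norm_eq_abs] at h4
      linarith [hbound p]
    have h5 : ‖p‖ = max ‖p.1.1‖ ‖p.1.2‖ := rfl
    rw [h5, add_mul]
    exact max_le (h1.trans (by linarith [norm_nonneg (L p)]))
      (h2.trans (by have := mul_nonneg (by positivity : 0 ≤ 1 / |c|) (norm_nonneg (L p)); linarith))
  have hclosed : IsClosed (Set.range L) := by
    have : CompleteSpace A.graph := by
      have hcl : IsClosed (A.graph : Set (E × E)) := IsSelfAdjoint.isClosed hA
      exact hcl.completeSpace_coe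
    exact hanti.isClosed_range L.uniformContinuous
  -- The range of `A + ic` is dense, since a vector orthogonal to it is an eigenvector of `A` with
  -- the non-real eigenvalue `ic`.
  have htop : LinearMap.range L.toLinearMap = ⊤ := by
    have h1 : (LinearMap.range L.toLinearMap).topologicalClosure = LinearMap.range L.toLinearMap :=
      IsClosed.submodule_topologicalClosure_eq hclosed
    rw [← h1, Submodule.topologicalClosure_eq_top_iff, Submodule.eq_bot_iff]
    intro χ hχ
    have h2 : (χ, (Complex.I * c) • χ) ∈ A.graph := by
      rw [mem_graph_iff_of_isSelfAdjoint hA]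
      intro a b hab
      have h3 : ⟪b + (Complex.I * c) • a, χ⟫ = 0 :=
        (Submodule.mem_orthogonal _ _).1 hχ _ ⟨⟨(a, b), hab⟩, rfl⟩
      rw [inner_add_left, inner_smul_left] at h3
      rw [inner_smul_right]
      simp only [map_mul, Complex.conj_I, Complex.conj_ofReal] at h3
      linear_combination h3
    have h4 := norm_le_of_mem_graph hA (-c) h2
    rw [← add_smul] at h4
    simp only [Complex.ofReal_neg, mul_neg, add_neg_cancel, zero_smul, norm_zero, abs_neg] at h4
    exact norm_eq_zero.1 (le_antisymm (nonpos_of_mul_nonpos_right h4 hc') (norm_nonneg _))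
  let e : A.graph ≃ₗ[ℂ] E := LinearEquiv.ofBijective L.toLinearMap
    ⟨hanti.injective, LinearMap.range_eq_top.1 htop⟩
  have he : ∀ φ, L (e.symm φ) = φ := fun φ => e.apply_symm_apply φ
  let R : E →ₗ[ℂ] E := LinearMap.fst ℂ E E ∘ₗ A.graph.subtype ∘ₗ e.symm.toLinearMap
  have hR : ∀ φ, |c| * ‖R φ‖ ≤ ‖φ‖ := fun φ => by
    have := hbound (e.symm φ)
    rwa [he] at this
  refine ⟨R.mkContinuous (1 / |c|) fun φ => ?_, fun φ => ?_, hR⟩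
  · rw [div_mul_eq_mul_div, one_mul, le_div_iff₀ hc', mul_comm]
    exact hR φ
  · have h1 : φ - (Complex.I * c) • R φ = (e.symm φ).1.2 := by
      rw [sub_eq_iff_eq_add]
      exact (he φ).symm
    change (R φ, φ - (Complex.I * c) • R φ) ∈ A.graph
    rw [h1]
    exact (e.symm φ).2

/-- **Stone's theorem**, existence part.  The bounded approximations are the Yosida-type
operators `(c² / 2) ((A + ic)⁻¹ + (A - ic)⁻¹)` with `c → ∞`. -/
theorem exists_isUnitaryGroupOf {A : E →ₗ.[ℂ] E} (hA : IsSelfAdjoint A) :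
    ∃ U : ℝ → E →L[ℂ] E, IsUnitaryGroupOf A U := by
  choose! R hR hRn using fun (c : ℝ) (hc : c ≠ 0) => exists_resolvent hA hc
  have hRinv : ∀ c : ℝ, c ≠ 0 → ∀ ψ χ, (ψ, χ) ∈ A.graph → R c (χ + (Complex.I * c) • ψ) = ψ := by
    intro c hc ψ χ hp
    set φ := χ + (Complex.I * c) • ψ
    have h1 := norm_le_of_mem_graph hA c (A.graph.sub_mem (hR c hc φ) hp)
    have h2 : (φ - (Complex.I * c) • R c φ - χ) + (Complex.I * c) • (R c φ - ψ) = 0 := by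
      simp only [φ]
      module
    simp only at h1
    rw [h2, norm_zero] at h1
    exact sub_eq_zero.1 (norm_eq_zero.1
      (le_antisymm (nonpos_of_mul_nonpos_right h1 (abs_pos.2 hc)) (norm_nonneg _)))
  have hstar : ∀ c : ℝ, c ≠ 0 → star (R c) = R (-c) := by
    intro c hc
    refine ((ContinuousLinearMap.eq_adjoint_iff _ _).2 fun x y => ?_).symm
    have h1 := (mem_graph_iff_of_isSelfAdjoint hA).1 (hR c hc y) _ _ (hR (-c) (neg_ne_zero.2 hc) x)
    simp only [inner_sub_left, inner_sub_right, inner_smul_left, inner_smul_right, map_mul,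
      Complex.conj_I, Complex.conj_ofReal, Complex.ofReal_neg, map_neg] at h1
    linear_combination -h1
  have hcomm : ∀ c d : ℝ, c ≠ 0 → d ≠ 0 → Commute (R c) (R d) := by
    intro c d hc hd
    have key : ∀ c d : ℝ, c ≠ 0 → d ≠ 0 → R d - R c = (Complex.I * (c - d)) • (R c * R d) := by
      intro c d hc hd
      ext φ
      have h1 := hRinv c hc _ _ (hR d hd φ)
      have h2 : φ - (Complex.I * d) • R d φ + (Complex.I * c) • R d φ =
          φ + (Complex.I * (c - d)) • R d φ := by module
      rw [h2, map_add, map_smul] at h1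
      simp only [sub_apply, smul_apply, mul_apply_eq_comp]
      exact sub_eq_of_eq_add' h1.symm
    rcases eq_or_ne c d with rfl | hne
    · exact Commute.refl _
    · have h1 := key c d hc hd
      have h2 := key d c hd hc
      have h3 : Complex.I * ((c : ℂ) - d) ≠ 0 := mul_ne_zero Complex.I_ne_zero
        (sub_ne_zero.2 (by exact_mod_cast hne))
      have h4 : (Complex.I * ((c : ℂ) - d)) • (R c * R d) =
          (Complex.I * ((c : ℂ) - d)) • (R d * R c) := by
        rw [← h1, ← neg_sub, h2, ← neg_smul]
        congr 1
        ring
      exact smul_right_injective _ h3 h4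
  let c : ℕ → ℝ := fun n => (n : ℝ) + 1
  have hc : ∀ n, c n ≠ 0 := fun n => by positivity
  have hcpos : ∀ n, 0 < c n := fun n => by positivity
  have hctop : Tendsto c atTop atTop :=
    tendsto_atTop_add_const_right _ _ tendsto_natCast_atTop_atTop
  have hcn : ∀ n, -c n ≠ 0 := fun n => neg_ne_zero.2 (hc n)
  -- `± ic (A ± ic)⁻¹ → 1` strongly.
  have hJ : ∀ ε : ℝ, |ε| = 1 → ∀ φ, Tendsto
      (fun n => (Complex.I * (ε * c n : ℝ)) • R (ε * c n) φ) atTop (𝓝 φ) := by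
    intro ε hε φ
    have hε0 : ε ≠ 0 := fun h => by simp [h] at hε
    have hne : ∀ n, ε * c n ≠ 0 := fun n => mul_ne_zero hε0 (hc n)
    have habs : ∀ n, |ε * c n| = c n := fun n => by
      rw [abs_mul, hε, one_mul, abs_of_pos (hcpos n)]
    have hcontr : ∀ n x, ‖(Complex.I * (ε * c n : ℝ)) • R (ε * c n) x‖ ≤ ‖x‖ := fun n x => by
      rw [norm_smul, norm_mul, Complex.norm_I, one_mul, Complex.norm_real, Real.norm_eq_abs]
      exact hRn _ (hne n) x
    rw [Metric.tendsto_atTop]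
    intro δ hδ
    obtain ⟨ψ, hψ, hd⟩ := hA.dense_domain.exists_dist_lt φ (show 0 < δ / 3 by positivity)
    have hmem := A.mem_graph ⟨ψ, hψ⟩
    set χ := A ⟨ψ, hψ⟩
    have hψ' : ∀ n, (Complex.I * (ε * c n : ℝ)) • R (ε * c n) ψ - ψ = - R (ε * c n) χ := by
      intro n
      have := hRinv _ (hne n) ψ χ hmem
      rw [map_add, map_smul] at this
      nth_rw 2 [← this]
      abel
    have hlim : Tendsto (fun n => ‖χ‖ / c n) atTop (𝓝 0) := tendsto_const_nhds.div_atTop hctop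
    obtain ⟨M, hM⟩ := eventually_atTop.1
      (hlim.eventually (gt_mem_nhds (show 0 < δ / 3 by positivity)))
    refine ⟨M, fun n hn => ?_⟩
    have h1 : ‖(Complex.I * (ε * c n : ℝ)) • R (ε * c n) ψ - ψ‖ < δ / 3 := by
      rw [hψ', norm_neg]
      refine lt_of_le_of_lt ?_ (hM n hn)
      rw [le_div_iff₀ (hcpos n), mul_comm]
      have := hRn _ (hne n) χ
      rwa [habs] at this
    rw [dist_eq_norm] at hd ⊢
    have h2 : (Complex.I * (ε * c n : ℝ)) • R (ε * c n) φ - φ =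
        (Complex.I * (ε * c n : ℝ)) • R (ε * c n) (φ - ψ) +
          ((Complex.I * (ε * c n : ℝ)) • R (ε * c n) ψ - ψ) - (φ - ψ) := by
      rw [map_sub, smul_sub]
      abel
    rw [h2]
    have h3 := hcontr n (φ - ψ)
    have h4 := norm_sub_le ((Complex.I * (ε * c n : ℝ)) • R (ε * c n) (φ - ψ) +
          ((Complex.I * (ε * c n : ℝ)) • R (ε * c n) ψ - ψ)) (φ - ψ)
    have h5 := norm_add_le ((Complex.I * (ε * c n : ℝ)) • R (ε * c n) (φ - ψ))
          ((Complex.I * (ε * c n : ℝ)) • R (ε * c n) ψ - ψ)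
    linarith
  refine exists_isUnitaryGroupOf_of_tendsto hA.dense_domain
    (B := fun n => ((c n ^ 2 / 2 : ℝ) : ℂ) • (R (c n) + R (-c n))) (fun n => ?_) (fun m n => ?_)
    fun ψ χ hp => ?_
  · rw [IsSelfAdjoint, star_smul, star_add, hstar _ (hc n), hstar _ (hcn n), neg_neg, add_comm]
    simp
  · refine (Commute.smul_left ?_ _).smul_right _
    exact ((hcomm _ _ (hc m) (hc n)).add_left (hcomm _ _ (hcn m) (hc n))).add_right
      ((hcomm _ _ (hc m) (hcn n)).add_left (hcomm _ _ (hcn m) (hcn n)))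
  · have h1 := ((hJ 1 (by simp) χ).add (hJ (-1) (by simp) χ)).const_smul (1 / 2 : ℂ)
    have h2 : (1 / 2 : ℂ) • (χ + χ) = χ := by module
    rw [h2] at h1
    -- On the domain of `A` the approximations are the averages of `± ic (A ± ic)⁻¹ A`.
    refine h1.congr fun n => ?_
    have h3 := hRinv _ (hc n) ψ χ hp
    have h4 := hRinv _ (hcn n) ψ χ hp
    rw [map_add, map_smul] at h3 h4
    simp only [one_mul, neg_one_mul, Complex.ofReal_neg, smul_apply,
      add_apply] at h3 h4 ⊢
    have e1 : R (c n) χ = ψ - (Complex.I * c n) • R (c n) ψ := eq_sub_of_add_eq h3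
    have e2 : R (-c n) χ = ψ - (Complex.I * -c n) • R (-c n) ψ := eq_sub_of_add_eq h4
    rw [e1, e2]
    push_cast
    match_scalars
    · ring
    · ring_nf
      simp
      ring
    · ring_nf
      simp
      ring

end Stone

end OscillatorChain

noncomputable section

namespace OscillatorChain

/-! ### Sums over configurations -/

section Product

variable {R : Type*} [NormedCommRing R]

lemma summable_norm_prod_pi {α : Type*} {N : ℕ} {f : Fin N → α → R}
    (hf : ∀ k, Summable fun a => ‖f k a‖) :
    Summable fun m : Fin N → α => ‖∏ k, f k (m k)‖ := by
  induction N with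
  | zero => exact .of_finite
  | succ N ih =>
    rw [← (Fin.consEquiv fun _ => α).summable_iff]
    refine ((hf 0).mul_norm (ih fun k => hf k.succ)).congr fun p => ?_
    simp [Fin.consEquiv, Fin.prod_univ_succ]

lemma tsum_prod_pi [CompleteSpace R] {α : Type*} {N : ℕ} {f : Fin N → α → R}
    (hf : ∀ k, Summable fun a => ‖f k a‖) :
    ∑' m : Fin N → α, ∏ k, f k (m k) = ∏ k, ∑' a, f k a := by
  induction N with
  | zero => simp [tsum_fintype]
  | succ N ih =>
    rw [← (Fin.consEquiv fun _ => α).tsum_eq, Fin.prod_univ_succ, ← ih fun k => hf k.succ,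
      tsum_mul_tsum_of_summable_norm (hf 0) (summable_norm_prod_pi fun k => hf k.succ)]
    exact tsum_congr fun p => by simp [Fin.consEquiv, Fin.prod_univ_succ]

/-- Occupation numbers of the chain, as families of occupation numbers of the sites. -/
abbrev siteEquiv (N : ℕ) : (Fin N × Fin 2 → ℕ) ≃ (Fin N → Fin 2 → ℕ) := Equiv.curry _ _ _

lemma summable_norm_prod_site {N : ℕ} {f : Fin N → (Fin 2 → ℕ) → R}
    (hf : ∀ k, Summable fun a => ‖f k a‖) :
    Summable fun m : Fin N × Fin 2 → ℕ => ‖∏ k, f k (siteEquiv N m k)‖ :=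
  ((siteEquiv N).summable_iff (f := fun m : Fin N → Fin 2 → ℕ => ‖∏ k, f k (m k)‖)).2
    (summable_norm_prod_pi hf)

lemma tsum_prod_site [CompleteSpace R] {N : ℕ} {f : Fin N → (Fin 2 → ℕ) → R}
    (hf : ∀ k, Summable fun a => ‖f k a‖) :
    ∑' m : Fin N × Fin 2 → ℕ, ∏ k, f k (siteEquiv N m k) = ∏ k, ∑' a, f k a := by
  rw [← tsum_prod_pi hf]
  exact (siteEquiv N).tsum_eq fun m : Fin N → Fin 2 → ℕ => ∏ k, f k (m k)

end Product

section Fock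

variable {ι : Type}

lemma summable_norm_sq (ψ : Fock ι) : Summable fun n => ‖ψ n‖ ^ 2 := by
  simpa using (lp.memℓp ψ).summable (by norm_num)

lemma norm_sq_eq_tsum (ψ : Fock ι) : ‖ψ‖ ^ 2 = ∑' n, ‖ψ n‖ ^ 2 := by
  simpa using lp.norm_rpow_eq_tsum (p := 2) (by norm_num) ψ

lemma memℓp_two {f : (ι → ℕ) → ℂ} (hf : Summable fun n => ‖f n‖ ^ 2) :
    Memℓp f 2 := memℓp_gen (by simpa using hf)

lemma fock_ext {ψ φ : Fock ι} (h : ∀ n, ψ n = φ n) : ψ = φ := lp.ext (funext h)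

variable [Fintype ι] [DecidableEq ι]

lemma ket_apply (n m : ι → ℕ) : (ket n : Fock ι) m = if m = n then 1 else 0 := by
  rw [ket, lp.single_apply]
  split_ifs with h
  · subst h; simp
  · simp [h]

lemma inner_ket (n : ι → ℕ) (ψ : Fock ι) : ⟪(ket n : Fock ι), ψ⟫ = ψ n := by
  rw [ket, lp.inner_single_left]
  simp

lemma dense_span_ket : Dense (Submodule.span ℂ (Set.range (ket (ι := ι))) : Set (Fock ι)) := by
  intro ψ
  refine mem_closure_of_tendsto (lp.hasSum_single (by norm_num) ψ)
    (Eventually.of_forall fun s => Submodule.sum_mem _ fun n _ => ?_)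
  have h1 : (lp.single 2 n (ψ n) : Fock ι) = ψ n • ket n := by
    rw [ket, ← lp.single_smul, smul_eq_mul, mul_one]
  rw [h1]
  exact Submodule.smul_mem _ _ (Submodule.subset_span ⟨n, rfl⟩)

lemma ext_ket {F : Type*} [AddCommGroup F] [Module ℂ F] [TopologicalSpace F] [T2Space F]
    {S T : Fock ι →L[ℂ] F} (h : ∀ n, S (ket n) = T (ket n)) : S = T :=
  ContinuousLinearMap.ext_on dense_span_ket (by rintro _ ⟨n, rfl⟩; exact h n)

lemma continuous_apply_of_ket {U : ℝ → Fock ι →L[ℂ] Fock ι} (hU : ∀ t ψ, ‖U t ψ‖ ≤ ‖ψ‖)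
    (hc : ∀ n, Continuous fun t => U t (ket n)) (ψ : Fock ι) : Continuous fun t => U t ψ := by
  refine continuous_apply_of_dense hU dense_span_ket (fun φ hφ => ?_) ψ
  induction hφ using Submodule.span_induction with
  | mem x hx => obtain ⟨n, rfl⟩ := hx; exact hc n
  | zero => simpa using continuous_const
  | add x y _ _ hx hy => simp only [map_add]; exact hx.add hy
  | smul c x _ hx => simp only [map_smul]; exact hx.const_smul c

end Fock

/-! ### Product vectors -/

lemma prod_update_apply {N : ℕ} (φ : Fin N → SiteSpace) (k : Fin N) (x : SiteSpace)
    (m : Fin N → Fin 2 → ℕ) :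
    ∏ j, Function.update φ k x j (m j) = x (m k) * ∏ j ∈ Finset.univ.erase k, φ j (m j) := by
  rw [← Finset.mul_prod_erase _ _ (Finset.mem_univ k), Function.update_self]
  congr 1
  exact Finset.prod_congr rfl fun j hj => by rw [Function.update_of_ne (Finset.ne_of_mem_erase hj)]

lemma summable_norm_sq_prod {N : ℕ} (φ : Fin N → SiteSpace) :
    Summable fun m : Fin N × Fin 2 → ℕ => ‖∏ k, φ k (siteEquiv N m k)‖ ^ 2 := by
  have h1 := summable_norm_prod_site (N := N) (f := fun k a => ‖φ k a‖ ^ 2)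
    fun k => by simpa using summable_norm_sq (φ k)
  refine h1.congr fun m => ?_
  rw [Real.norm_of_nonneg (by positivity), Finset.prod_pow, ← norm_prod]

lemma tsum_norm_sq_prod {N : ℕ} (φ : Fin N → SiteSpace) :
    ∑' m : Fin N × Fin 2 → ℕ, ‖∏ k, φ k (siteEquiv N m k)‖ ^ 2 = (∏ k, ‖φ k‖) ^ 2 := by
  have h1 := tsum_prod_site (N := N) (f := fun k a => ‖φ k a‖ ^ 2)
    fun k => by simpa using summable_norm_sq (φ k)
  simp only [← norm_sq_eq_tsum] at h1
  rw [← Finset.prod_pow, ← h1]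
  exact tsum_congr fun m => by rw [norm_prod, Finset.prod_pow]

/-- The product vector `φ₁ ⊗ ⋯ ⊗ φ_N` of the chain, as a continuous multilinear function of its
factors. -/
def pureTensor (N : ℕ) : ContinuousMultilinearMap ℂ (fun _ : Fin N => SiteSpace) (ChainSpace N) :=
  MultilinearMap.mkContinuous
    { toFun := fun φ => ⟨fun m => ∏ k, φ k (siteEquiv N m k), memℓp_two (summable_norm_sq_prod φ)⟩
      map_update_add' := fun {inst} φ k x y => by
        obtain rfl : inst = instDecidableEqFin N := Subsingleton.elim _ _
        refine fock_ext fun m => ?_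
        have h := prod_update_apply φ k (x + y) (siteEquiv N m)
        rw [lp.coeFn_add, Pi.add_apply, add_mul, ← prod_update_apply, ← prod_update_apply] at h
        exact h
      map_update_smul' := fun {inst} φ k c x => by
        obtain rfl : inst = instDecidableEqFin N := Subsingleton.elim _ _
        refine fock_ext fun m => ?_
        have h := prod_update_apply φ k (c • x) (siteEquiv N m)
        rw [lp.coeFn_smul, Pi.smul_apply, smul_eq_mul, mul_assoc, ← prod_update_apply] at h
        exact h }
    1 fun φ => by
      rw [one_mul]
      refine le_of_eq ((sq_eq_sq₀ (norm_nonneg _) (by positivity)).1 ?_)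
      rw [norm_sq_eq_tsum, ← tsum_norm_sq_prod]
      rfl

lemma pureTensor_apply {N : ℕ} (φ : Fin N → SiteSpace) (m : Fin N × Fin 2 → ℕ) :
    pureTensor N φ m = ∏ k, φ k (siteEquiv N m k) := rfl

lemma pureTensor_ket {N : ℕ} (m : Fin N × Fin 2 → ℕ) :
    pureTensor N (fun k => ket (siteEquiv N m k)) = ket m := by
  refine fock_ext fun n => ?_
  simp only [pureTensor_apply, ket_apply, Finset.prod_ite_zero, Finset.prod_const_one]
  congr 1
  rw [← (siteEquiv N).apply_eq_iff_eq, funext_iff]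
  simp

lemma ext_pureTensor {N : ℕ} {S T : ChainSpace N →L[ℂ] ChainSpace N}
    (h : ∀ φ, S (pureTensor N φ) = T (pureTensor N φ)) : S = T :=
  ext_ket fun m => by rw [← pureTensor_ket, h]

/-! ### Operators acting at one site -/

section Slice

variable {N : ℕ} (k : Fin N)

lemma slice_apply (m : Fin N × Fin 2 → ℕ) (ψ : ChainSpace N) (a : Fin 2 → ℕ) :
    slice k m ψ a = ψ (insertSite k m a) := rfl

lemma siteEquiv_insertSite (m : Fin N × Fin 2 → ℕ) (a : Fin 2 → ℕ) :
    siteEquiv N (insertSite k m a) = Function.update (siteEquiv N m) k a := by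
  ext j α
  by_cases h : j = k
  · subst h
    simp [insertSite]
  · simp [insertSite, h]

lemma insertSite_self (m : Fin N × Fin 2 → ℕ) : insertSite k m (siteEquiv N m k) = m := by
  apply (siteEquiv N).injective
  rw [siteEquiv_insertSite, Function.update_eq_self]

lemma insertSite_insertSite (m : Fin N × Fin 2 → ℕ) (a b : Fin 2 → ℕ) :
    insertSite k (insertSite k m a) b = insertSite k m b := by
  apply (siteEquiv N).injective
  simp only [siteEquiv_insertSite, Function.update_idem]

lemma slice_insertSite (m : Fin N × Fin 2 → ℕ) (a : Fin 2 → ℕ) :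
    slice k (insertSite k m a) = slice k m := by
  ext ψ b
  rw [slice_apply, slice_apply, insertSite_insertSite]

lemma ext_slice {ψ φ : ChainSpace N} (h : ∀ m, slice k m ψ = slice k m φ) : ψ = φ :=
  fock_ext fun m => by
    rw [← insertSite_self k m, ← slice_apply, ← slice_apply, h]

lemma slice_pureTensor (m : Fin N × Fin 2 → ℕ) (φ : Fin N → SiteSpace) :
    slice k m (pureTensor N φ) =
      (∏ j ∈ Finset.univ.erase k, φ j (siteEquiv N m j)) • φ k := by
  refine fock_ext fun a => ?_
  rw [slice_apply, pureTensor_apply, siteEquiv_insertSite,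
    ← Finset.mul_prod_erase _ _ (Finset.mem_univ k), Function.update_self, mul_comm]
  change _ = _ * φ k a
  congr 1
  exact Finset.prod_congr rfl fun j hj => by rw [Function.update_of_ne (Finset.ne_of_mem_erase hj)]

/-- Occupation numbers of all oscillators outside the site `k`. -/
abbrev Environment : Type := {i : Fin N × Fin 2 // i.1 ≠ k} → ℕ

/-- The extension of the occupation numbers outside the site `k` by the vacuum at `k`. -/
def Environment.extend (r : Environment k) : Fin N × Fin 2 → ℕ :=
  fun i => if h : i.1 = k then 0 else r ⟨i, h⟩

/-- Occupation numbers of the chain, split into those outside the site `k` and those at `k`. -/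
def splitEquiv : Environment k × (Fin 2 → ℕ) ≃ (Fin N × Fin 2 → ℕ) where
  toFun p := insertSite k (p.1.extend k) p.2
  invFun m := (fun i => m i, siteEquiv N m k)
  left_inv p := by
    refine Prod.ext (funext fun i => ?_) ?_
    · simp [insertSite, Environment.extend, i.2]
    · simp only [siteEquiv_insertSite, Function.update_self]
  right_inv m := by
    funext i
    by_cases h : i.1 = k
    · subst h
      simp [insertSite]
    · simp [insertSite, Environment.extend, h]

lemma summable_iff_split {F : (Fin N × Fin 2 → ℕ) → ℝ} (hF : ∀ m, 0 ≤ F m) :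
    Summable F ↔ (∀ r : Environment k, Summable fun a => F (insertSite k (r.extend k) a)) ∧
      Summable fun r : Environment k => ∑' a, F (insertSite k (r.extend k) a) := by
  rw [← (splitEquiv k).summable_iff]
  exact summable_prod_of_nonneg (f := F ∘ splitEquiv k) fun p => hF _

lemma summable_norm_sq_slice (ψ : ChainSpace N) :
    Summable fun r : Environment k => ‖slice k (r.extend k) ψ‖ ^ 2 := by
  simp only [norm_sq_eq_tsum]
  exact ((summable_iff_split k fun m => by positivity).1 (summable_norm_sq ψ)).2

/-- Norms on the chain are computed slice by slice, which makes operators acting at one site as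
bounded as their one-site factor. -/
lemma norm_sq_eq_tsum_slice (ψ : ChainSpace N) :
    ‖ψ‖ ^ 2 = ∑' r : Environment k, ‖slice k (r.extend k) ψ‖ ^ 2 := by
  simp only [norm_sq_eq_tsum]
  rw [← (splitEquiv k).tsum_eq]
  have h := (splitEquiv k).summable_iff.2 (summable_norm_sq ψ)
  exact h.tsum_prod' fun r => summable_norm_sq (slice k (r.extend k) ψ)

lemma norm_slice_le (m : Fin N × Fin 2 → ℕ) (ψ : ChainSpace N) : ‖slice k m ψ‖ ≤ ‖ψ‖ := by
  rw [← sq_le_sq₀ (norm_nonneg _) (norm_nonneg _), norm_sq_eq_tsum, norm_sq_eq_tsum ψ]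
  exact tsum_comp_le_tsum_of_inj (summable_norm_sq ψ) (fun _ => by positivity)
    (insertSite_injective k m)

/-- The partial inner product `slice k m` as a bounded operator. -/
def sliceL (m : Fin N × Fin 2 → ℕ) : ChainSpace N →L[ℂ] SiteSpace :=
  (slice k m).mkContinuous 1 fun ψ => by
    rw [one_mul]
    exact norm_slice_le k m ψ

lemma norm_sq_map_slice_le (T : SiteSpace →L[ℂ] SiteSpace) (ψ : ChainSpace N)
    (m : Fin N × Fin 2 → ℕ) :
    ‖T (slice k m ψ)‖ ^ 2 ≤ ‖T‖ ^ 2 * ‖slice k m ψ‖ ^ 2 := by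
  rw [← mul_pow]
  exact pow_le_pow_left₀ (norm_nonneg _) (T.le_opNorm _) 2

lemma memℓp_lift (T : SiteSpace →L[ℂ] SiteSpace) (ψ : ChainSpace N) :
    Memℓp (fun m => T (slice k m ψ) (siteEquiv N m k)) 2 := by
  refine memℓp_two ((summable_iff_split k fun m => by positivity).2 ?_)
  simp only [slice_insertSite, siteEquiv_insertSite, Function.update_self, ← norm_sq_eq_tsum]
  exact ⟨fun r => summable_norm_sq _,
    ((summable_norm_sq_slice k ψ).mul_left (‖T‖ ^ 2)).of_nonneg_of_le
      (fun _ => by positivity) fun r => norm_sq_map_slice_le k T ψ _⟩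

/-- The linear map `1 ⊗ ⋯ ⊗ T ⊗ ⋯ ⊗ 1` acting as the bounded operator `T` at the site `k`. -/
def liftₗ (T : SiteSpace →L[ℂ] SiteSpace) : ChainSpace N →ₗ[ℂ] ChainSpace N where
  toFun ψ := ⟨fun m => T (slice k m ψ) (siteEquiv N m k), memℓp_lift k T ψ⟩
  map_add' ψ φ := by
    ext m
    simp only [map_add]
    rfl
  map_smul' c ψ := by
    ext m
    simp only [map_smul]
    rfl

lemma slice_liftₗ (T : SiteSpace →L[ℂ] SiteSpace) (m : Fin N × Fin 2 → ℕ) (ψ : ChainSpace N) :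
    slice k m (liftₗ k T ψ) = T (slice k m ψ) := by
  refine fock_ext fun a => ?_
  change T (slice k (insertSite k m a) ψ) (siteEquiv N (insertSite k m a) k) = _
  rw [slice_insertSite, siteEquiv_insertSite, Function.update_self]

/-- The bounded operator `1 ⊗ ⋯ ⊗ T ⊗ ⋯ ⊗ 1` acting as `T` at the site `k`. -/
def lift (T : SiteSpace →L[ℂ] SiteSpace) : ChainSpace N →L[ℂ] ChainSpace N :=
  (liftₗ k T).mkContinuous ‖T‖ fun ψ => by
    rw [← sq_le_sq₀ (norm_nonneg _) (by positivity), mul_pow, norm_sq_eq_tsum_slice k,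
      norm_sq_eq_tsum_slice k ψ, ← tsum_mul_left]
    refine Summable.tsum_le_tsum (fun r => ?_) (summable_norm_sq_slice k _)
      ((summable_norm_sq_slice k ψ).mul_left _)
    rw [slice_liftₗ]
    exact norm_sq_map_slice_le k T ψ _

lemma slice_lift (T : SiteSpace →L[ℂ] SiteSpace) (m : Fin N × Fin 2 → ℕ) (ψ : ChainSpace N) :
    slice k m (lift k T ψ) = T (slice k m ψ) := slice_liftₗ k T m ψ

lemma lift_one : lift k (1 : SiteSpace →L[ℂ] SiteSpace) = 1 :=
  ContinuousLinearMap.ext fun ψ => ext_slice k fun m => slice_lift k 1 m ψ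

lemma lift_mul (S T : SiteSpace →L[ℂ] SiteSpace) : lift k (S * T) = lift k S * lift k T :=
  ContinuousLinearMap.ext fun ψ => ext_slice k fun m => by
    simp only [mul_apply_eq_comp, slice_lift]

lemma norm_lift_apply {T : SiteSpace →L[ℂ] SiteSpace} (hT : ∀ ψ, ‖T ψ‖ = ‖ψ‖) (ψ : ChainSpace N) :
    ‖lift k T ψ‖ = ‖ψ‖ := by
  rw [← sq_eq_sq₀ (norm_nonneg _) (norm_nonneg _), norm_sq_eq_tsum_slice k,
    norm_sq_eq_tsum_slice k ψ]
  simp only [slice_lift, hT]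

lemma lift_pureTensor (T : SiteSpace →L[ℂ] SiteSpace) (φ : Fin N → SiteSpace) :
    lift k T (pureTensor N φ) = pureTensor N (Function.update φ k (T (φ k))) := by
  refine ext_slice k fun m => ?_
  rw [slice_lift, slice_pureTensor, slice_pureTensor, map_smul, Function.update_self]
  congr 1
  exact Finset.prod_congr rfl fun j hj => by rw [Function.update_of_ne (Finset.ne_of_mem_erase hj)]

lemma IsUnitaryGroup.lift {T : ℝ → SiteSpace →L[ℂ] SiteSpace} (hT : IsUnitaryGroup T) :
    IsUnitaryGroup fun t => OscillatorChain.lift k (T t) := by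
  have hn := fun t ψ => norm_lift_apply k (hT.norm_apply t) ψ
  refine .of_norm_apply (by rw [hT.map_zero, lift_one]) (fun s t => by rw [hT.map_add, lift_mul])
    hn (continuous_apply_of_ket (fun t ψ => (hn t ψ).le) fun n => ?_)
  simp only [← pureTensor_ket, lift_pureTensor]
  exact (pureTensor N).cont.comp (continuous_const.update k (hT.continuous _))

lemma hasOrbitDeriv_lift {Y : SiteSpace →ₗ.[ℂ] SiteSpace} {T : ℝ → SiteSpace →L[ℂ] SiteSpace}
    (hT : IsUnitaryGroupOf Y T) {ψ χ : ChainSpace N} (h : (ψ, χ) ∈ atSiteGraph k Y) :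
    HasOrbitDeriv (fun t => lift k (T t)) ψ (Complex.I • χ) := by
  refine (hT.isUnitaryGroup.lift k).hasOrbitDeriv_of_intertwine hT.isUnitaryGroup
    (S := sliceL k) (fun x y => ext_slice k) (fun m t x => slice_lift k (T t) m x) fun m => ?_
  rw [map_smul]
  exact hT.hasOrbitDeriv_of_mem_graph ((Submodule.mem_iInf _).1 h m)

end Slice

/-! ### Tensor powers of bounded operators -/

lemma list_lift_pureTensor {N : ℕ} (T : SiteSpace →L[ℂ] SiteSpace) (L : List (Fin N))
    (hL : L.Nodup) (φ : Fin N → SiteSpace) :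
    (L.map fun k => lift k T).prod (pureTensor N φ) =
      pureTensor N fun k => if k ∈ L then T (φ k) else φ k := by
  induction L with
  | nil => simp
  | cons k L ih =>
    obtain ⟨hk, hL⟩ := List.nodup_cons.1 hL
    rw [List.map_cons, List.prod_cons, mul_apply_eq_comp, ih hL, lift_pureTensor]
    congr 1
    funext j
    rcases eq_or_ne j k with rfl | hj
    · simp [hk]
    · simp [hj]

/-- The operator `T ⊗ ⋯ ⊗ T` of the chain, as a product of operators acting at one site. -/
def tensorPowFun (N : ℕ) (T : SiteSpace →L[ℂ] SiteSpace) : ChainSpace N →L[ℂ] ChainSpace N :=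
  ((List.finRange N).map fun k => lift k T).prod

lemma tensorPowFun_pureTensor {N : ℕ} (T : SiteSpace →L[ℂ] SiteSpace) (φ : Fin N → SiteSpace) :
    tensorPowFun N T (pureTensor N φ) = pureTensor N fun k => T (φ k) := by
  rw [tensorPowFun, list_lift_pureTensor _ _ (List.nodup_finRange N)]
  simp

/-- The operator `T ⊗ ⋯ ⊗ T` of the chain is multiplicative in `T`. -/
def tensorPow (N : ℕ) : (SiteSpace →L[ℂ] SiteSpace) →* (ChainSpace N →L[ℂ] ChainSpace N) where
  toFun := tensorPowFun N
  map_one' := ext_pureTensor fun φ => by rw [tensorPowFun_pureTensor]; rfl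
  map_mul' S T := ext_pureTensor fun φ => by
    simp only [mul_apply_eq_comp, tensorPowFun_pureTensor]

lemma tensorPow_apply (N : ℕ) (T : SiteSpace →L[ℂ] SiteSpace) :
    tensorPow N T = ((List.finRange N).map fun k => lift k T).prod := rfl

lemma tensorPow_pureTensor {N : ℕ} (T : SiteSpace →L[ℂ] SiteSpace) (φ : Fin N → SiteSpace) :
    tensorPow N T (pureTensor N φ) = pureTensor N fun k => T (φ k) := tensorPowFun_pureTensor T φ

lemma IsUnitaryGroup.tensorPow {N : ℕ} {T : ℝ → SiteSpace →L[ℂ] SiteSpace}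
    (hT : IsUnitaryGroup T) : IsUnitaryGroup fun t => OscillatorChain.tensorPow N (T t) := by
  have hu : ∀ t, OscillatorChain.tensorPow N (T t) ∈ unitary (ChainSpace N →L[ℂ] ChainSpace N) := by
    intro t
    rw [tensorPow_apply]
    refine Submonoid.list_prod_mem _ fun x hx => ?_
    obtain ⟨k, -, rfl⟩ := List.mem_map.1 hx
    exact (hT.lift k).mem_unitary t
  refine ⟨by rw [hT.map_zero, map_one], fun s t => by rw [hT.map_add, map_mul], hu,
    continuous_apply_of_ket (fun t ψ => (Unitary.norm_map ⟨_, hu t⟩ ψ).le) fun n => ?_⟩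
  simp only [← pureTensor_ket, tensorPow_pureTensor]
  exact (pureTensor N).cont.comp (continuous_pi fun k => hT.continuous _)

/-! ### Graphs of sums of partially defined operators -/

section Graph

variable {E : Type*} [AddCommGroup E] [Module ℂ E]

lemma mem_graph_add {f g : E →ₗ.[ℂ] E} {x y : E} :
    (x, y) ∈ (f + g).graph ↔ ∃ a b, (x, a) ∈ f.graph ∧ (x, b) ∈ g.graph ∧ a + b = y := by
  constructor
  · intro h
    obtain ⟨z, rfl, rfl⟩ := (LinearPMap.mem_graph_iff _).1 h
    exact ⟨_, _, f.mem_graph ⟨z, z.2.1⟩, g.mem_graph ⟨z, z.2.2⟩, rfl⟩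
  · rintro ⟨a, b, ha, hb, rfl⟩
    obtain ⟨z, hz, rfl⟩ := (LinearPMap.mem_graph_iff _).1 ha
    obtain ⟨w, hw, rfl⟩ := (LinearPMap.mem_graph_iff _).1 hb
    simp only at hz hw
    subst hz
    have h := (f + g).mem_graph ⟨z, z.2, hw ▸ w.2⟩
    rw [LinearPMap.add_apply] at h
    have hw' : w = ⟨z, hw ▸ w.2⟩ := Subtype.ext hw
    rw [hw']
    exact h

lemma mem_graph_smul {f : E →ₗ.[ℂ] E} {c : ℂ} {x y : E} :
    (x, y) ∈ (c • f).graph ↔ ∃ a, (x, a) ∈ f.graph ∧ c • a = y := by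
  simp only [LinearPMap.mem_graph_iff]
  constructor
  · rintro ⟨z, rfl, rfl⟩
    exact ⟨_, ⟨z, rfl, rfl⟩, rfl⟩
  · rintro ⟨_, ⟨z, rfl, rfl⟩, rfl⟩
    exact ⟨z, rfl, rfl⟩

lemma mem_graph_finsetSum {ι : Type*} (s : Finset ι) {f : ι → E →ₗ.[ℂ] E} {x y : E} :
    (x, y) ∈ (∑ i ∈ s, f i).graph ↔
      ∃ η : ι → E, (∀ i ∈ s, (x, η i) ∈ (f i).graph) ∧ ∑ i ∈ s, η i = y := by
  classical
  induction s using Finset.induction_on generalizing y with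
  | empty =>
    simp only [Finset.sum_empty, Finset.notMem_empty, false_implies, implies_true, true_and,
      exists_const, LinearPMap.mem_graph_iff]
    constructor
    · rintro ⟨z, -, rfl⟩
      rfl
    · rintro rfl
      exact ⟨⟨x, trivial⟩, rfl, rfl⟩
  | insert i s hi ih =>
    rw [Finset.sum_insert hi, mem_graph_add]
    constructor
    · rintro ⟨a, b, ha, hb, rfl⟩
      obtain ⟨η, hη, rfl⟩ := ih.1 hb
      have hne : ∀ j ∈ s, j ≠ i := fun j hj h => hi (h ▸ hj)
      refine ⟨Function.update η i a, fun j hj => ?_, ?_⟩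
      · rcases Finset.mem_insert.1 hj with rfl | hj
        · simpa using ha
        · simpa [Function.update_of_ne (hne j hj)] using hη j hj
      · rw [Finset.sum_insert hi, Function.update_self]
        congr 1
        exact Finset.sum_congr rfl fun j hj => Function.update_of_ne (hne j hj) _ _
    · rintro ⟨η, hη, rfl⟩
      exact ⟨η i, ∑ j ∈ s, η j, hη i (Finset.mem_insert_self _ _),
        ih.2 ⟨η, fun j hj => hη j (Finset.mem_insert_of_mem hj), rfl⟩, (Finset.sum_insert hi).symm⟩

lemma mem_graph_sum {ι : Type*} [Fintype ι] {f : ι → E →ₗ.[ℂ] E} {x y : E} :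
    (x, y) ∈ (∑ i, f i).graph ↔ ∃ η : ι → E, (∀ i, (x, η i) ∈ (f i).graph) ∧ ∑ i, η i = y := by
  rw [mem_graph_finsetSum]
  simp only [Finset.mem_univ, forall_const]

end Graph

/-- No closability is needed: `LinearPMap.closure` leaves an operator without closure unchanged. -/
lemma closure_graph_subset {E : Type*} [NormedAddCommGroup E] [InnerProductSpace ℂ E]
    [CompleteSpace E] (A : E →ₗ.[ℂ] E) : (A.closure.graph : Set (E × E)) ⊆ closure A.graph := by
  by_cases h : A.IsClosable
  · rw [← h.graph_closure_eq_closure_graph]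
    exact Submodule.topologicalClosure_coe _ |>.le
  · rw [LinearPMap.closure_def' h]
    exact subset_closure

/-! ### The exponential of a mean-field operator -/

lemma mem_graph_meanField {N : ℕ} {Y : SiteSpace →ₗ.[ℂ] SiteSpace} {ψ χ : ChainSpace N} :
    (ψ, χ) ∈ (meanField N Y).graph ↔
      ∃ η : Fin N → ChainSpace N, (∀ k, (ψ, η k) ∈ atSiteGraph k Y) ∧
        (N : ℂ)⁻¹ • ∑ k, η k = χ := by
  rw [meanField, mem_graph_smul]
  simp only [mem_graph_sum, atSite_graph]
  constructor
  · rintro ⟨_, ⟨η, hη, rfl⟩, rfl⟩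
    exact ⟨η, hη, rfl⟩
  · rintro ⟨η, hη, rfl⟩
    exact ⟨_, ⟨η, hη, rfl⟩, rfl⟩

lemma mem_atSiteGraph {N : ℕ} {k : Fin N} {Y : SiteSpace →ₗ.[ℂ] SiteSpace} {ψ χ : ChainSpace N} :
    (ψ, χ) ∈ atSiteGraph k Y ↔ ∀ m, (slice k m ψ, slice k m χ) ∈ Y.graph :=
  Submodule.mem_iInf _

lemma meanField_graph_mono {N : ℕ} {Y Z : SiteSpace →ₗ.[ℂ] SiteSpace} (h : Y ≤ Z) :
    (meanField N Y).graph ≤ (meanField N Z).graph := by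
  rintro ⟨ψ, χ⟩ hp
  obtain ⟨η, hη, rfl⟩ := mem_graph_meanField.1 hp
  exact mem_graph_meanField.2 ⟨η, fun k => mem_atSiteGraph.2 fun m =>
    LinearPMap.le_graph_of_le h (mem_atSiteGraph.1 (hη k) m), rfl⟩

lemma pureTensor_mem_atSiteGraph {N : ℕ} (k : Fin N) {Y : SiteSpace →ₗ.[ℂ] SiteSpace}
    {φ : Fin N → SiteSpace} {x : SiteSpace} (h : (φ k, x) ∈ Y.graph) :
    (pureTensor N φ, pureTensor N (Function.update φ k x)) ∈ atSiteGraph k Y := by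
  refine mem_atSiteGraph.2 fun m => ?_
  have h1 : ∏ j ∈ Finset.univ.erase k, Function.update φ k x j (siteEquiv N m j) =
      ∏ j ∈ Finset.univ.erase k, φ j (siteEquiv N m j) :=
    Finset.prod_congr rfl fun j hj => by rw [Function.update_of_ne (Finset.ne_of_mem_erase hj)]
  rw [slice_pureTensor, slice_pureTensor, Function.update_self, h1]
  exact Y.graph.smul_mem _ h

/-- The vector `N⁻¹ ∑ₖ φ₁ ⊗ ⋯ ⊗ ηₖ ⊗ ⋯ ⊗ φ_N`: the value of the mean-field operator of `Y` at
the product vector `φ₁ ⊗ ⋯ ⊗ φ_N` when `ηₖ = Y φₖ`. -/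
def meanFieldProduct (N : ℕ) (φ η : Fin N → SiteSpace) : ChainSpace N :=
  (N : ℂ)⁻¹ • ∑ k, pureTensor N (Function.update φ k (η k))

lemma pureTensor_mem_graph_meanField {N : ℕ} {Y : SiteSpace →ₗ.[ℂ] SiteSpace}
    {φ η : Fin N → SiteSpace} (h : ∀ k, (φ k, η k) ∈ Y.graph) :
    (pureTensor N φ, meanFieldProduct N φ η) ∈ (meanField N Y).graph :=
  mem_graph_meanField.2 ⟨_, fun k => pureTensor_mem_atSiteGraph k (h k), rfl⟩

lemma tensorPow_meanFieldProduct {N : ℕ} (T : SiteSpace →L[ℂ] SiteSpace)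
    (φ η : Fin N → SiteSpace) :
    tensorPow N T (meanFieldProduct N φ η) =
      meanFieldProduct N (fun k => T (φ k)) fun k => T (η k) := by
  simp only [meanFieldProduct, map_smul, map_sum, tensorPow_pureTensor]
  congr 1
  refine Finset.sum_congr rfl fun k _ => ?_
  congr 1
  funext j
  rcases eq_or_ne j k with rfl | hj
  · simp
  · simp [hj]

/-- If `T t = e^{itY}`, then `e^{itY/N} ⊗ ⋯ ⊗ e^{itY/N}` is a unitary group whose generator extends
the mean-field operator of `Y`.  For `N = 0` both are trivial, since `0⁻¹ = 0`. -/
lemma IsUnitaryGroupOf.meanField {N : ℕ} {Y : SiteSpace →ₗ.[ℂ] SiteSpace}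
    {T : ℝ → SiteSpace →L[ℂ] SiteSpace} (hT : IsUnitaryGroupOf Y T) :
    IsUnitaryGroupOf (OscillatorChain.meanField N Y) fun t => tensorPow N (T ((N : ℝ)⁻¹ * t)) := by
  have hG := hT.isUnitaryGroup.comp_mul (N : ℝ)⁻¹
  refine hG.tensorPow.isUnitaryGroupOf fun ψ χ hp => ?_
  obtain ⟨η, hη, rfl⟩ := mem_graph_meanField.1 hp
  have h1 := hasOrbitDeriv_list_prod (fun k : Fin N => hG.lift k)
    (fun k => (hasOrbitDeriv_lift k hT (hη k)).comp_mul (N : ℝ)⁻¹) (List.finRange N)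
  rw [← Fin.sum_univ_def] at h1
  have h2 : ∑ k, (((N : ℝ)⁻¹ : ℝ) : ℂ) • Complex.I • η k = Complex.I • (N : ℂ)⁻¹ • ∑ k, η k := by
    rw [← Finset.smul_sum, ← Finset.smul_sum, smul_comm]
    push_cast
    rfl
  rw [h2] at h1
  exact h1

/-- A unitary group is unique once its generator is known to act as the mean-field operator of an
essentially self-adjoint `Y` on product vectors over the domain of `Y`.  The generator is closed, so
it acts in this way on product vectors over the domain of the closure of `Y` too, and these are
invariant under `e^{itY/N} ⊗ ⋯ ⊗ e^{itY/N}` and total. -/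
lemma IsUnitaryGroupOf.eq_tensorPow {N : ℕ} {Y : SiteSpace →ₗ.[ℂ] SiteSpace}
    (hY : IsEssentiallySelfAdjoint Y) (hket : ∀ a, ket a ∈ Y.domain)
    {T : ℝ → SiteSpace →L[ℂ] SiteSpace} (hT : IsUnitaryGroupOf Y.closure T)
    {A : ChainSpace N →ₗ.[ℂ] ChainSpace N}
    (hprod : ∀ φ η : Fin N → SiteSpace, (∀ k, (φ k, η k) ∈ Y.graph) →
      (pureTensor N φ, meanFieldProduct N φ η) ∈ A.graph)
    {U : ℝ → ChainSpace N →L[ℂ] ChainSpace N} (hU : IsUnitaryGroupOf A U) (t : ℝ) :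
    U t = tensorPow N (T ((N : ℝ)⁻¹ * t)) := by
  have hgen : ∀ φ η : Fin N → SiteSpace, (∀ k, (φ k, η k) ∈ Y.closure.graph) →
      HasOrbitDeriv U (pureTensor N φ) (Complex.I • meanFieldProduct N φ η) := by
    intro φ η h
    let G : (Fin N → SiteSpace × SiteSpace) → ChainSpace N × ChainSpace N := fun p =>
      (pureTensor N fun k => (p k).1,
        Complex.I • meanFieldProduct N (fun k => (p k).1) fun k => (p k).2)
    have hG : Continuous G := by
      have h1 : Continuous fun p : Fin N → SiteSpace × SiteSpace => fun k => (p k).1 := by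
        fun_prop
      have h2 : Continuous fun p : Fin N → SiteSpace × SiteSpace =>
          ∑ k, pureTensor N (Function.update (fun j => (p j).1) k (p k).2) :=
        continuous_finsetSum _ fun k _ => (pureTensor N).cont.comp (h1.update k (by fun_prop))
      exact ((pureTensor N).cont.comp h1).prodMk
        ((h2.const_smul (N : ℂ)⁻¹).const_smul Complex.I)
    have h1 : (fun k => (φ k, η k)) ∈
        closure (Set.univ.pi fun _ : Fin N => (Y.graph : Set (SiteSpace × SiteSpace))) := by
      rw [closure_pi_set]
      exact fun k _ => closure_graph_subset Y (h k)
    have h2 := map_mem_closure hG h1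
      (t := {q : ChainSpace N × ChainSpace N | HasOrbitDeriv U q.1 q.2}) fun p hp =>
        hU.hasOrbitDeriv_of_mem_graph (hprod _ _ fun k => hp k trivial)
    rwa [hU.isUnitaryGroup.isClosed_generator.closure_eq] at h2
  refine ext_ket fun m => ?_
  rw [← pureTensor_ket]
  have hmem : ∀ k, (ket (siteEquiv N m k), Y ⟨_, hket (siteEquiv N m k)⟩) ∈ Y.closure.graph :=
    fun k => LinearPMap.le_graph_of_le Y.le_closure (Y.mem_graph ⟨_, hket (siteEquiv N m k)⟩)
  have hV := hT.meanField (N := N)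
  refine hU.isUnitaryGroup.apply_eq_of_orbit hV.isUnitaryGroup
    (hV.hasOrbitDeriv_of_mem_graph (pureTensor_mem_graph_meanField hmem)) (fun s => ?_) t
  rw [tensorPow_pureTensor, map_smul, tensorPow_meanFieldProduct]
  exact hgen _ _ fun k => hT.apply_mem_graph hY _ (hmem k)

/-- The exponential of an operator `A` that lies between the mean-field operator of an essentially
self-adjoint `Y` and its restriction to product vectors. -/
lemma unitaryExp_eq_tensorPow {N : ℕ} {Y : SiteSpace →ₗ.[ℂ] SiteSpace}
    (hY : IsEssentiallySelfAdjoint Y) (hket : ∀ a, ket a ∈ Y.domain)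
    {T : ℝ → SiteSpace →L[ℂ] SiteSpace} (hT : IsUnitaryGroupOf Y.closure T)
    {A : ChainSpace N →ₗ.[ℂ] ChainSpace N} (hA : A.graph ≤ (meanField N Y).graph)
    (hprod : ∀ φ η : Fin N → SiteSpace, (∀ k, (φ k, η k) ∈ Y.graph) →
      (pureTensor N φ, meanFieldProduct N φ η) ∈ A.graph) :
    unitaryExp A = tensorPow N (T (N : ℝ)⁻¹) := by
  have hex : ∃ U : ℝ → ChainSpace N →L[ℂ] ChainSpace N, IsUnitaryGroupOf A U :=
    ⟨_, hT.meanField.mono (hA.trans (meanField_graph_mono Y.le_closure))⟩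
  rw [unitaryExp, dif_pos hex, hT.eq_tensorPow hY hket hprod hex.choose_spec, mul_one]

lemma unitaryExp_meanField (N : ℕ) {Y : SiteSpace →ₗ.[ℂ] SiteSpace}
    (hY : IsEssentiallySelfAdjoint Y) (hket : ∀ a, ket a ∈ Y.domain)
    {T : ℝ → SiteSpace →L[ℂ] SiteSpace} (hT : IsUnitaryGroupOf Y.closure T) :
    unitaryExp (meanField N Y) = tensorPow N (T (N : ℝ)⁻¹) :=
  unitaryExp_eq_tensorPow hY hket hT le_rfl fun _ _ => pureTensor_mem_graph_meanField

/-- The operator `∑ⱼ Xⱼ^{(N)}` may have a smaller domain than `(∑ⱼ Xⱼ)^{(N)}`, but both contain the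
product vectors over the domain of `∑ⱼ Xⱼ`, which determine the exponential. -/
lemma unitaryExp_sum_meanField (N : ℕ) {n : ℕ} {X : Fin n → (SiteSpace →ₗ.[ℂ] SiteSpace)}
    (hX : IsEssentiallySelfAdjoint (∑ j, X j)) (hket : ∀ a, ket a ∈ (∑ j, X j).domain)
    {T : ℝ → SiteSpace →L[ℂ] SiteSpace} (hT : IsUnitaryGroupOf (∑ j, X j).closure T) :
    unitaryExp (∑ j, meanField N (X j)) = tensorPow N (T (N : ℝ)⁻¹) := by
  refine unitaryExp_eq_tensorPow hX hket hT ?_ fun φ η h => ?_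
  · rintro ⟨ψ, χ⟩ hp
    obtain ⟨ξ, hξ, rfl⟩ := mem_graph_sum.1 hp
    choose η hη hsum using fun j => mem_graph_meanField.1 (hξ j)
    refine mem_graph_meanField.2 ⟨fun k => ∑ j, η j k, fun k => mem_atSiteGraph.2 fun m => ?_, ?_⟩
    · rw [map_sum]
      exact mem_graph_sum.2 ⟨_, fun j => mem_atSiteGraph.1 (hη j k) m, rfl⟩
    · rw [Finset.sum_comm, Finset.smul_sum]
      exact Finset.sum_congr rfl fun j _ => hsum j
  · choose ξ hξ hsum using fun k => mem_graph_sum.1 (h k)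
    refine mem_graph_sum.2 ⟨fun j => meanFieldProduct N φ fun k => ξ k j,
      fun j => pureTensor_mem_graph_meanField fun k => hξ k j, ?_⟩
    simp only [meanFieldProduct]
    rw [← Finset.smul_sum, Finset.sum_comm]
    congr 1
    refine Finset.sum_congr rfl fun k _ => ?_
    rw [← hsum k]
    exact ((pureTensor N).toMultilinearMap.map_update_sum Finset.univ k (ξ k) φ).symm

/-! ### Thermal expectations of product operators -/

lemma expectation_eq {ι : Type} [Fintype ι] [DecidableEq ι] (β ω : ℝ) {O : Fock ι →ₗ.[ℂ] Fock ι}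
    {x : (ι → ℕ) → Fock ι} (h : ∀ n, (ket n, x n) ∈ O.graph) :
    expectation β ω O = ∑' n, (gibbsWeight β ω n : ℂ) * x n n := by
  refine tsum_congr fun n => ?_
  obtain ⟨y, hy, hx⟩ := (LinearPMap.mem_graph_iff _).1 (h n)
  simp only at hy hx
  have hmem : ket n ∈ O.domain := hy ▸ y.2
  obtain rfl : y = ⟨ket n, hmem⟩ := Subtype.ext hy
  rw [dif_pos (show ket n ∈ ((gibbs β ω : Fock ι →L[ℂ] Fock ι).toLinearMap.compPMap O).domain
    from hmem), inner_ket, ← hx]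
  rfl

lemma boundedExpectation_eq {ι : Type} [Fintype ι] [DecidableEq ι] (β ω : ℝ)
    (O : Fock ι →L[ℂ] Fock ι) :
    boundedExpectation β ω O = ∑' n, (gibbsWeight β ω n : ℂ) * O (ket n) n :=
  expectation_eq β ω fun n => (LinearPMap.mem_graph_iff _).2 ⟨⟨ket n, trivial⟩, rfl, rfl⟩

lemma summable_exp_energy {β ω : ℝ} (hβ : 0 < β) (hω : 0 < ω) :
    Summable fun a : Fin 2 → ℕ => Real.exp (-β * energy ω a) := by
  have h1 : Summable fun n : ℕ => ‖Real.exp (-β * (ω * ((n : ℝ) + 1 / 2)))‖ := by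
    have hr : Real.exp (-(β * ω)) < 1 := by
      rw [Real.exp_lt_one_iff]
      exact neg_lt_zero.2 (mul_pos hβ hω)
    refine ((summable_geometric_of_lt_one (Real.exp_pos _).le hr).mul_left
      (Real.exp (-β * ω / 2))).congr fun n => ?_
    rw [Real.norm_of_nonneg (Real.exp_pos _).le, ← Real.exp_nat_mul, ← Real.exp_add]
    congr 1
    ring
  refine (summable_norm_prod_pi (N := 2) fun _ => h1).congr fun a => ?_
  rw [← Real.exp_sum, Real.norm_of_nonneg (Real.exp_pos _).le, energy_eq, Finset.mul_sum,
    Finset.mul_sum]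

lemma gibbsWeight_nonneg {ι : Type} [Fintype ι] [DecidableEq ι] (β ω : ℝ) (n : ι → ℕ) :
    0 ≤ gibbsWeight β ω n :=
  div_nonneg (Real.exp_pos _).le (tsum_nonneg fun _ => (Real.exp_pos _).le)

lemma summable_gibbsWeight {β ω : ℝ} (hβ : 0 < β) (hω : 0 < ω) :
    Summable fun a : Fin 2 → ℕ => gibbsWeight β ω a :=
  (summable_exp_energy hβ hω).div_const _

lemma tsum_gibbsWeight {β ω : ℝ} (hβ : 0 < β) (hω : 0 < ω) :
    ∑' a : Fin 2 → ℕ, gibbsWeight β ω a = 1 := by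
  simp only [gibbsWeight]
  rw [tsum_div_const]
  exact div_self ((summable_exp_energy hβ hω).tsum_pos (fun _ => (Real.exp_pos _).le) 0
    (Real.exp_pos _)).ne'

/-- The Gibbs state of the chain is the tensor power of the one-site Gibbs state. -/
lemma gibbsWeight_eq_prod {β ω : ℝ} (hβ : 0 < β) (hω : 0 < ω) {N : ℕ} (m : Fin N × Fin 2 → ℕ) :
    gibbsWeight β ω m = ∏ k, gibbsWeight β ω (siteEquiv N m k) := by
  have h1 : ∀ m : Fin N × Fin 2 → ℕ, Real.exp (-β * energy ω m) =
      ∏ k, Real.exp (-β * energy ω (siteEquiv N m k)) := by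
    intro m
    simp only [← Real.exp_sum, energy_eq, Fintype.sum_prod_type, Finset.mul_sum]
    rfl
  have h2 := tsum_prod_site (N := N) (f := fun _ a => Real.exp (-β * energy ω a))
    fun _ => (summable_exp_energy hβ hω).norm
  simp only [gibbsWeight, Finset.prod_div_distrib]
  rw [← h2, ← h1, tsum_congr h1]

lemma norm_coe_le (ψ : SiteSpace) (a : Fin 2 → ℕ) : ‖ψ a‖ ≤ ‖ψ‖ :=
  lp.norm_apply_le_norm (by norm_num) ψ a

lemma norm_ket (a : Fin 2 → ℕ) : ‖(ket a : SiteSpace)‖ = 1 := by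
  rw [ket, lp.norm_single (by norm_num), norm_one]

lemma norm_gibbsWeight_mul_le (β ω : ℝ) (ψ : SiteSpace) (a : Fin 2 → ℕ) :
    ‖(gibbsWeight β ω a : ℂ) * ψ a‖ ≤ gibbsWeight β ω a * ‖ψ‖ := by
  rw [norm_mul, Complex.norm_real, Real.norm_of_nonneg (gibbsWeight_nonneg β ω a)]
  exact mul_le_mul_of_nonneg_left (norm_coe_le ψ a) (gibbsWeight_nonneg β ω a)

lemma summable_gibbsWeight_mul {β ω : ℝ} {x : (Fin 2 → ℕ) → SiteSpace}
    (hx : Summable fun a => gibbsWeight β ω a * ‖x a‖) :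
    Summable fun a => ‖(gibbsWeight β ω a : ℂ) * x a a‖ :=
  hx.of_nonneg_of_le (fun _ => norm_nonneg _) fun a => norm_gibbsWeight_mul_le β ω (x a) a

lemma boundedExpectation_tensorPow {β ω : ℝ} (hβ : 0 < β) (hω : 0 < ω) (N : ℕ)
    (S : SiteSpace →L[ℂ] SiteSpace) :
    boundedExpectation β ω (tensorPow N S) = boundedExpectation β ω S ^ N := by
  have h1 : Summable fun a => gibbsWeight β ω a * ‖S (ket a)‖ :=
    ((summable_gibbsWeight hβ hω).mul_right ‖S‖).of_nonneg_of_le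
      (fun a => mul_nonneg (gibbsWeight_nonneg β ω a) (norm_nonneg _)) fun a => by
        refine mul_le_mul_of_nonneg_left ?_ (gibbsWeight_nonneg β ω a)
        simpa [norm_ket] using S.le_opNorm (ket a)
  have h2 := tsum_prod_site (N := N) (f := fun _ a => (gibbsWeight β ω a : ℂ) * S (ket a) a)
    fun _ => summable_gibbsWeight_mul h1
  rw [Finset.prod_const, Finset.card_univ, Fintype.card_fin] at h2
  rw [boundedExpectation_eq, boundedExpectation_eq, ← h2]
  refine tsum_congr fun m => ?_
  rw [← pureTensor_ket, tensorPow_pureTensor, pureTensor_apply, Finset.prod_mul_distrib,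
    gibbsWeight_eq_prod hβ hω, Complex.ofReal_prod]

/-! ### The mean-field limit -/

/-- The mean-field limit for products of one-site unitary groups: the expectation is the `N`-th
power of a one-site expectation of the form `1 + i ∑ⱼ ⟨Xⱼ⟩ / N + o(1 / N)`. -/
lemma tendsto_boundedExpectation_tensorPow {β ω : ℝ} (hβ : 0 < β) (hω : 0 < ω) {n : ℕ}
    {X : Fin n → (SiteSpace →ₗ.[ℂ] SiteSpace)} {T : Fin n → ℝ → SiteSpace →L[ℂ] SiteSpace}
    (hT : ∀ j, IsUnitaryGroupOf (X j) (T j)) {x : Fin n → (Fin 2 → ℕ) → SiteSpace}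
    (hx : ∀ j a, (ket a, x j a) ∈ (X j).graph)
    (hs : ∀ j, Summable fun a => gibbsWeight β ω a * ‖x j a‖) :
    Tendsto (fun N : ℕ => boundedExpectation β ω
        (tensorPow N (List.ofFn fun j => T j (N : ℝ)⁻¹).prod)) atTop
      (𝓝 (Complex.exp (Complex.I * ∑ j, expectation β ω (X j)))) := by
  let S : ℝ → SiteSpace →L[ℂ] SiteSpace := fun t => ((List.finRange n).map fun j => T j t).prod
  have hG := fun j => (hT j).isUnitaryGroup
  have hd := fun j a => (hT j).hasOrbitDeriv_of_mem_graph (hx j a)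
  have hS : ∀ a, HasOrbitDeriv S (ket a) (∑ j, Complex.I • x j a) := fun a => by
    rw [Fin.sum_univ_def]
    exact hasOrbitDeriv_list_prod hG (fun j => hd j a) _
  have hS' : ∀ a t, ‖S t (ket a) - ket a‖ ≤ (∑ j, ‖x j a‖) * |t| := fun a t => by
    have h := norm_list_prod_sub_le hG (fun j => hd j a) (List.finRange n) t
    rw [← Fin.sum_univ_def] at h
    simpa [norm_smul] using h
  have hbound : Summable fun a => gibbsWeight β ω a * ∑ j, ‖x j a‖ := by
    simp only [Finset.mul_sum]
    exact summable_sum fun j _ => hs j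
  -- The deviation from `1` of the one-site expectation.  It is written as a sum over number states
  -- of deviations, to which dominated convergence applies after multiplication by `N`.
  let g : ℕ → ℂ := fun N => ∑' a, (gibbsWeight β ω a : ℂ) * (S (N : ℝ)⁻¹ (ket a) - ket a) a
  have hscale : ∀ (N : ℕ) a, ‖(N : ℂ) • (S (N : ℝ)⁻¹ (ket a) - ket a)‖ ≤ ∑ j, ‖x j a‖ := by
    intro N a
    have h0 : 0 ≤ ∑ j, ‖x j a‖ := by positivity
    rcases Nat.eq_zero_or_pos N with rfl | hN
    · simpa using h0
    · have hN' : (0 : ℝ) < N := Nat.cast_pos.2 hN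
      rw [norm_smul, Complex.norm_natCast]
      refine (mul_le_mul_of_nonneg_left (hS' a _) hN'.le).trans_eq ?_
      rw [abs_of_pos (inv_pos.2 hN')]
      field_simp
  have hlim : Tendsto (fun N : ℕ => (N : ℂ) * g N) atTop
      (𝓝 (Complex.I * ∑ j, expectation β ω (X j))) := by
    have h1 : Complex.I * ∑ j, expectation β ω (X j) =
        ∑' a, (gibbsWeight β ω a : ℂ) * (∑ j, Complex.I • x j a) a := by
      simp only [expectation_eq β ω (hx _)]
      rw [← Summable.tsum_finsetSum fun j _ => (summable_gibbsWeight_mul (hs j)).of_norm,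
        ← tsum_mul_left]
      refine tsum_congr fun a => ?_
      rw [← Finset.smul_sum, lp.coeFn_smul, lp.coeFn_sum]
      simp only [Pi.smul_apply, Finset.sum_apply, smul_eq_mul, Finset.mul_sum]
      exact Finset.sum_congr rfl fun j _ => by ring
    have h2 : ∀ N : ℕ, (N : ℂ) * g N = ∑' a, (gibbsWeight β ω a : ℂ) *
        ((N : ℂ) • (S (N : ℝ)⁻¹ (ket a) - ket a)) a := by
      intro N
      simp only [g]
      rw [← tsum_mul_left]
      refine tsum_congr fun a => ?_
      rw [lp.coeFn_smul, Pi.smul_apply, smul_eq_mul, mul_left_comm]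
    simp only [h1, h2]
    refine tendsto_tsum_of_dominated_convergence hbound (fun a => ?_)
      (Eventually.of_forall fun N a => ?_)
    · have h3 := (hS a).tendsto_natCast_smul (list_prod_map_zero hG _)
      have h4 := (tendsto_const_nhds (x := (ket a : SiteSpace))).inner h3 (𝕜 := ℂ)
      simp only [inner_ket] at h4
      exact h4.const_mul _
    · exact (norm_gibbsWeight_mul_le β ω _ a).trans
        (mul_le_mul_of_nonneg_left (hscale N a) (gibbsWeight_nonneg β ω a))
  refine (Complex.tendsto_one_add_pow_exp_of_tendsto hlim).congr' ?_
  filter_upwards [eventually_gt_atTop 0] with N hN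
  have hN' : (N : ℂ) ≠ 0 := Nat.cast_ne_zero.2 hN.ne'
  rw [boundedExpectation_tensorPow hβ hω, List.ofFn_eq_map, boundedExpectation_eq]
  congr 1
  have h1 : ∑' a : Fin 2 → ℕ, (gibbsWeight β ω a : ℂ) = 1 := by
    rw [← Complex.ofReal_tsum, tsum_gibbsWeight hβ hω, Complex.ofReal_one]
  have h2 : Summable fun a : Fin 2 → ℕ => (gibbsWeight β ω a : ℂ) :=
    Complex.summable_ofReal.2 (summable_gibbsWeight hβ hω)
  have h3 : Summable fun a => gibbsWeight β ω a * ‖S (N : ℝ)⁻¹ (ket a) - ket a‖ := by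
    refine Summable.of_nonneg_of_le
      (fun a => mul_nonneg (gibbsWeight_nonneg β ω a) (norm_nonneg _)) (fun a => ?_) hbound
    refine mul_le_mul_of_nonneg_left ?_ (gibbsWeight_nonneg β ω a)
    refine (hS' a _).trans (mul_le_of_le_one_right (Finset.sum_nonneg fun j _ => norm_nonneg _) ?_)
    rw [abs_of_nonneg (inv_nonneg.2 (Nat.cast_nonneg N))]
    exact Nat.cast_inv_le_one N
  rw [← h1, ← h2.tsum_add (summable_gibbsWeight_mul h3).of_norm]
  refine tsum_congr fun a => ?_
  have h4 : (S (N : ℝ)⁻¹ (ket a) - ket a) a = S (N : ℝ)⁻¹ (ket a) a - 1 := by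
    rw [lp.coeFn_sub, Pi.sub_apply, ket_apply a a, if_pos rfl]
  rw [h4, mul_sub, mul_one, add_sub_cancel]

lemma IsObservable.summable_firstMoment {β ω : ℝ} (hβ : 0 < β) (hω : 0 < ω)
    {X : SiteSpace →ₗ.[ℂ] SiteSpace} (hX : IsObservable β ω X) :
    Summable fun a => gibbsWeight β ω a * ‖X ⟨ket a, hX.ket_mem a⟩‖ := by
  refine ((summable_gibbsWeight hβ hω).add hX.secondMoment).of_nonneg_of_le
    (fun a => mul_nonneg (gibbsWeight_nonneg β ω a) (norm_nonneg _)) fun a => ?_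
  rw [← mul_one_add]
  refine mul_le_mul_of_nonneg_left ?_ (gibbsWeight_nonneg β ω a)
  nlinarith [sq_nonneg (‖X ⟨ket a, hX.ket_mem a⟩‖ - 1)]

end OscillatorChain

end

open OscillatorChain in
theorem mainTheorem4 (β ω : ℝ) (hβ : 0 < β) (hω : 0 < ω) (n : ℕ)
    (X : Fin n → (SiteSpace →ₗ.[ℂ] SiteSpace)) (hX : ∀ j, IsObservable β ω (X j)) :
    Tendsto
        (fun N : ℕ => boundedExpectation β ω
          (List.ofFn fun j : Fin n => unitaryExp (meanField N (X j))).prod)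
        atTop (𝓝 (Complex.exp (Complex.I * ∑ j, expectation β ω (X j)))) ∧
      (IsEssentiallySelfAdjoint (∑ j, X j) →
        Tendsto
          (fun N : ℕ => boundedExpectation β ω (unitaryExp (∑ j, meanField N (X j))))
          atTop (𝓝 (Complex.exp (Complex.I * ∑ j, expectation β ω (X j))))) := by
  have hx := fun j a => (X j).mem_graph ⟨ket a, (hX j).ket_mem a⟩
  have hs := fun j => (hX j).summable_firstMoment hβ hω
  refine ⟨?_, fun hsum => ?_⟩
  · choose T hT using fun j => exists_isUnitaryGroupOf (hX j).essentiallySelfAdjoint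
    refine (tendsto_boundedExpectation_tensorPow hβ hω
      (fun j => (hT j).mono (LinearPMap.le_graph_of_le (X j).le_closure)) hx hs).congr fun N => ?_
    rw [map_list_prod, List.map_ofFn]
    congr 3
    funext j
    exact (unitaryExp_meanField N (hX j).essentiallySelfAdjoint (hX j).ket_mem (hT j)).symm
  · obtain ⟨T, hT⟩ := exists_isUnitaryGroupOf hsum
    have hx' : ∀ a, (ket a, ∑ j, X j ⟨ket a, (hX j).ket_mem a⟩) ∈ (∑ j, X j).graph := fun a =>
      mem_graph_sum.2 ⟨_, fun j => hx j a, rfl⟩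
    have hs' : Summable fun a => gibbsWeight β ω a * ‖∑ j, X j ⟨ket a, (hX j).ket_mem a⟩‖ := by
      refine (summable_sum fun j (_ : j ∈ Finset.univ) => hs j).of_nonneg_of_le
        (fun a => mul_nonneg (gibbsWeight_nonneg β ω a) (norm_nonneg _)) fun a => ?_
      rw [← Finset.mul_sum]
      exact mul_le_mul_of_nonneg_left (norm_sum_le _ _) (gibbsWeight_nonneg β ω a)
    have hexp : expectation β ω (∑ j, X j) = ∑ j, expectation β ω (X j) := by
      rw [expectation_eq β ω hx']
      simp only [expectation_eq β ω (hx _)]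
      rw [← Summable.tsum_finsetSum fun j _ => (summable_gibbsWeight_mul (hs j)).of_norm]
      refine tsum_congr fun a => ?_
      rw [lp.coeFn_sum, Finset.sum_apply, Finset.mul_sum]
    -- The single observable `∑ⱼ Xⱼ` is a case of the limit for products, with one factor.
    have h := tendsto_boundedExpectation_tensorPow hβ hω (n := 1) (X := fun _ => ∑ j, X j)
      (fun _ => hT.mono (LinearPMap.le_graph_of_le (∑ j, X j).le_closure)) (fun _ => hx')
      fun _ => hs'
    simp only [Finset.univ_unique, Finset.sum_const, Finset.card_singleton, one_smul, hexp] at h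
    refine h.congr fun N => ?_
    rw [unitaryExp_sum_meanField N hsum (fun a => LinearPMap.mem_domain_of_mem_graph (hx' a)) hT]
    simp
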